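/- Throughout, for a $C^*$-algebra $A$ (not necessarily unital) put $A_\infty=\ell^\infty(A)/c_0(A)$, regard $A$ as embedded in $A_\infty$ by constant sequences, let $\mathrm{Ann}(A)=\{x\in A_\infty\cap A' : xa=0 \text{ for all } a\in A\}$, and put $F_\infty(A)=(A_\infty\cap A')/\mathrm{Ann}(A)$; if $A$ is separable, this algebra is unital. An action of a topological group $G$ on $A$ is a homomorphism $\alpha\colon G\to\mathrm{Aut}(A)$ such that $g\mapsto\alpha_g(a)$ is norm continuous for every $a\in A$. It induces an action of $G$ (by automorphisms, coordinatewise) on $F_\infty(A)$, and $F_\infty^{(\alpha)}(A)$ denotes the set of $x\in F_\infty(A)$ whose orbit map $G\to F_\infty(A)$ is norm continuous. Let $G$ be a compact group, acting on $C(G)$ by $(g\cdot f)(x)=f(g^{-1}x)$, and let $\alpha$ be an action of $G$ on a separable $C^*$-algebra $A$. For an integer $d\ge 0$ write $\dim_{\mathrm{Rok}}^{\mathrm{c}}(\alpha)\le d$ if there are $G$-equivariant completely positive contractive order zero maps $\varphi_0,\dots,\varphi_d\colon C(G)\to F_\infty^{(\alpha)}(A)$ such that $\varphi_i(f)\varphi_j(h)=\varphi_j(h)\varphi_i(f)$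 for all $i\ne j$ and $f,h\in C(G)$, and $\sum_{i=0}^d\varphi_i(1)=1$. (Order zero means that $\varphi_i(f)\varphi_i(h)=0$ whenever $fh=0$.) The Rokhlin dimension with commuting towers $\dim_{\mathrm{Rok}}^{\mathrm{c}}(\alpha)\in\{0,1,2,\dots\}\cup\{\infty\}$ is the least such $d$, and $\infty$ if there is none. **Proposition.** For $j=1,2$ let $H_j$ be a compact Lie group, let $B_j$ be a separable $C^*$-algebra, and let $\beta^{(j)}$ be an action of $H_j$ on $B_j$. Let $\alpha\colon H_1\times H_2\to\mathrm{Aut}(B_1\otimes_{\max}B_2)$ be the action given by $\alpha_{(h_1,h_2)}=\beta^{(1)}_{h_1}\otimes\beta^{(2)}_{h_2}$. Then $$\dim_{\mathrm{Rok}}^{\mathrm{c}}(\alpha)\le\dim_{\mathrm{Rok}}^{\mathrm{c}}(\beta^{(1)})+\dim_{\mathrm{Rok}}^{\mathrm{c}}(\beta^{(2)}).$$ -/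

import Mathlib

open scoped TensorProduct ENNReal Topology ContDiff Manifold

noncomputable section

namespace CRokhlin

/-! ### Quotients of normed star algebras by closed two-sided star ideals -/

/-- A closed, self-adjoint, two-sided ideal of a complex normed star algebra. -/
structure ClosedStarIdeal (A : Type*) [NonUnitalNormedRing A] [StarRing A] [NormedSpace ℂ A]
    extends Submodule ℂ A where
  mul_left_mem : ∀ x a : A, a ∈ carrier → x * a ∈ carrier
  mul_right_mem : ∀ x a : A, a ∈ carrier → a * x ∈ carrier
  star_mem : ∀ a : A, a ∈ carrier → star a ∈ carrier
  isClosed : IsClosed carrier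

namespace ClosedStarIdeal

variable {A : Type*} [NonUnitalNormedRing A] [StarRing A] [NormedSpace ℂ A]

instance (I : ClosedStarIdeal A) : IsClosed (I.toSubmodule : Set A) := I.isClosed

/-- The quotient algebra; its norm is the quotient norm
`‖x + I‖ = inf {‖x + y‖ : y ∈ I}` of Mathlib. -/
def QuotAlg (I : ClosedStarIdeal A) : Type _ := A ⧸ I.toSubmodule

namespace QuotAlg

variable (I : ClosedStarIdeal A)

instance : NormedAddCommGroup I.QuotAlg :=
  inferInstanceAs (NormedAddCommGroup (A ⧸ I.toSubmodule))

instance : NormedSpace ℂ I.QuotAlg :=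
  inferInstanceAs (NormedSpace ℂ (A ⧸ I.toSubmodule))

instance [CompleteSpace A] : CompleteSpace I.QuotAlg :=
  inferInstanceAs (CompleteSpace (A ⧸ I.toSubmodule))

/-- The quotient map, as a linear map. -/
def mkL : A →ₗ[ℂ] I.QuotAlg := I.toSubmodule.mkQ

variable {I}

theorem mkL_surjective : Function.Surjective (mkL I) := I.toSubmodule.mkQ_surjective

theorem mkL_eq_iff {x y : A} : mkL I x = mkL I y ↔ x - y ∈ I.toSubmodule :=
  Submodule.Quotient.eq I.toSubmodule

theorem norm_mkL_le (x : A) : ‖mkL I x‖ ≤ ‖x‖ := Submodule.Quotient.norm_mk_le I.toSubmodule x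

theorem exists_norm_lt (x : I.QuotAlg) {ε : ℝ} (hε : 0 < ε) :
    ∃ a, mkL I a = x ∧ ‖a‖ < ‖x‖ + ε := Submodule.Quotient.norm_mk_lt x hε

instance : Mul I.QuotAlg where
  mul := _root_.Quotient.map₂ (· * ·) (by
    intro a a' h b b' h'
    have h1 : a - a' ∈ I.toSubmodule := (Submodule.quotientRel_def _).1 h
    have h2 : b - b' ∈ I.toSubmodule := (Submodule.quotientRel_def _).1 h'
    refine (Submodule.quotientRel_def _).2 ?_
    have : a * b - a' * b' = (a - a') * b + a' * (b - b') := by noncomm_ring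
    rw [this]
    exact I.toSubmodule.add_mem (I.mul_right_mem _ _ h1) (I.mul_left_mem _ _ h2))

theorem mkL_mul (x y : A) : mkL I (x * y) = mkL I x * mkL I y := rfl

instance : NonUnitalRing I.QuotAlg where
  left_distrib a b c := by
    obtain ⟨a, rfl⟩ := mkL_surjective a
    obtain ⟨b, rfl⟩ := mkL_surjective b
    obtain ⟨c, rfl⟩ := mkL_surjective c
    simp only [← map_add, ← mkL_mul, mul_add]
  right_distrib a b c := by
    obtain ⟨a, rfl⟩ := mkL_surjective a
    obtain ⟨b, rfl⟩ := mkL_surjective b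
    obtain ⟨c, rfl⟩ := mkL_surjective c
    simp only [← map_add, ← mkL_mul, add_mul]
  zero_mul a := by
    obtain ⟨a, rfl⟩ := mkL_surjective a
    rw [← map_zero (mkL I), ← mkL_mul, zero_mul]
  mul_zero a := by
    obtain ⟨a, rfl⟩ := mkL_surjective a
    rw [← map_zero (mkL I), ← mkL_mul, mul_zero]
  mul_assoc a b c := by
    obtain ⟨a, rfl⟩ := mkL_surjective a
    obtain ⟨b, rfl⟩ := mkL_surjective b
    obtain ⟨c, rfl⟩ := mkL_surjective c
    simp only [← mkL_mul, mul_assoc]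

instance : NonUnitalNormedRing I.QuotAlg where
  dist_eq := dist_eq_norm_neg_add
  norm_mul_le x y := by
    refine le_of_forall_pos_lt_add fun ε hε => ?_
    have hc : ContinuousAt (fun t : ℝ => (‖x‖ + t) * (‖y‖ + t)) 0 := by fun_prop
    have hlt : ∀ᶠ t in 𝓝[>] (0 : ℝ), (‖x‖ + t) * (‖y‖ + t) < ‖x‖ * ‖y‖ + ε :=
      (hc.tendsto.mono_left nhdsWithin_le_nhds).eventually_lt_const (by simpa using hε)
    obtain ⟨t, ht, ht0⟩ := (hlt.and self_mem_nhdsWithin).exists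
    obtain ⟨a, rfl, ha⟩ := exists_norm_lt x ht0
    obtain ⟨b, rfl, hb⟩ := exists_norm_lt y ht0
    calc ‖mkL I a * mkL I b‖ = ‖mkL I (a * b)‖ := rfl
      _ ≤ ‖a * b‖ := norm_mkL_le _
      _ ≤ ‖a‖ * ‖b‖ := norm_mul_le _ _
      _ ≤ (‖mkL I a‖ + t) * (‖mkL I b‖ + t) := by gcongr
      _ < _ := ht

instance [IsScalarTower ℂ A A] : IsScalarTower ℂ I.QuotAlg I.QuotAlg where
  smul_assoc c x y := by
    obtain ⟨x, rfl⟩ := mkL_surjective x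
    obtain ⟨y, rfl⟩ := mkL_surjective y
    simp only [smul_eq_mul, ← map_smul, ← mkL_mul, smul_mul_assoc]

instance [SMulCommClass ℂ A A] : SMulCommClass ℂ I.QuotAlg I.QuotAlg where
  smul_comm c x y := by
    obtain ⟨x, rfl⟩ := mkL_surjective x
    obtain ⟨y, rfl⟩ := mkL_surjective y
    simp only [smul_eq_mul, ← map_smul, ← mkL_mul, mul_smul_comm]

instance : Star I.QuotAlg where
  star := _root_.Quotient.map star (by
    intro a a' h
    have h1 : a - a' ∈ I.toSubmodule := (Submodule.quotientRel_def _).1 h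
    refine (Submodule.quotientRel_def _).2 ?_
    rw [← star_sub]
    exact I.star_mem _ h1)

theorem mkL_star (x : A) : mkL I (star x) = star (mkL I x) := rfl

instance : StarRing I.QuotAlg where
  star_involutive x := by
    obtain ⟨x, rfl⟩ := mkL_surjective x
    simp only [← mkL_star, star_star]
  star_mul x y := by
    obtain ⟨x, rfl⟩ := mkL_surjective x
    obtain ⟨y, rfl⟩ := mkL_surjective y
    simp only [← mkL_mul, ← mkL_star, star_mul]
  star_add x y := by
    obtain ⟨x, rfl⟩ := mkL_surjective x
    obtain ⟨y, rfl⟩ := mkL_surjective y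
    simp only [← map_add, ← mkL_star, star_add]

instance [StarModule ℂ A] : StarModule ℂ I.QuotAlg where
  star_smul c x := by
    obtain ⟨x, rfl⟩ := mkL_surjective x
    simp only [← map_smul, ← mkL_star, star_smul]

variable (I) in
/-- The quotient map, as a star homomorphism. -/
def mk : A →⋆ₙₐ[ℂ] I.QuotAlg where
  toFun := mkL I
  map_smul' := map_smul (mkL I)
  map_zero' := map_zero (mkL I)
  map_add' := map_add (mkL I)
  map_mul' := mkL_mul
  map_star' := mkL_star

theorem mk_surjective : Function.Surjective (mk I) := mkL_surjective

variable {B : Type*} [NonUnitalNormedRing B] [StarRing B] [NormedSpace ℂ B]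

/-- The map of quotients induced by a star homomorphism carrying one ideal into the other. -/
def map (I : ClosedStarIdeal A) (J : ClosedStarIdeal B) (φ : A →⋆ₙₐ[ℂ] B)
    (h : ∀ a ∈ I.toSubmodule, φ a ∈ J.toSubmodule) : I.QuotAlg →⋆ₙₐ[ℂ] J.QuotAlg :=
  let L : I.QuotAlg →ₗ[ℂ] J.QuotAlg :=
    Submodule.mapQ I.toSubmodule J.toSubmodule
      { toFun := φ, map_add' := map_add φ, map_smul' := map_smul φ } h
  have hL : ∀ a, L (mkL I a) = mkL J (φ a) := fun _ => rfl
  { toFun := L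
    map_smul' := map_smul L
    map_zero' := map_zero L
    map_add' := map_add L
    map_mul' := fun x y => by
      obtain ⟨x, rfl⟩ := mkL_surjective x
      obtain ⟨y, rfl⟩ := mkL_surjective y
      rw [← mkL_mul, hL, hL, hL, map_mul, mkL_mul]
    map_star' := fun x => by
      obtain ⟨x, rfl⟩ := mkL_surjective x
      rw [← mkL_star, hL, hL, map_star, mkL_star] }

theorem map_mk (I : ClosedStarIdeal A) (J : ClosedStarIdeal B) (φ : A →⋆ₙₐ[ℂ] B)
    (h : ∀ a ∈ I.toSubmodule, φ a ∈ J.toSubmodule) (a : A) :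
    map I J φ h (mk I a) = mk J (φ a) := rfl

end QuotAlg

end ClosedStarIdeal

open ClosedStarIdeal

/-! ### The sequence algebra and the central sequence algebra -/

section Sequence

variable (A : Type*) [NonUnitalCStarAlgebra A]

/-- `ℓ^∞(A)`, the bounded sequences in `A`. -/
abbrev BddSeq : Type _ := lp (fun _ : ℕ => A) ∞

variable {A} in
theorem BddSeq.norm_apply_le (x : BddSeq A) (n : ℕ) : ‖x n‖ ≤ ‖x‖ :=
  lp.norm_apply_le_norm (by simp) x n

/-- `c_0(A)`, the ideal of sequences that converge to zero. -/
def nullSeq : ClosedStarIdeal (BddSeq A) where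
  carrier := {x | Filter.Tendsto (fun n => x n) Filter.atTop (𝓝 0)}
  add_mem' := by
    intro x y hx hy
    simpa using Filter.Tendsto.add hx hy
  zero_mem' := by
    exact tendsto_const_nhds
  smul_mem' := by
    intro c x hx
    simpa using Filter.Tendsto.const_smul hx c
  mul_left_mem := by
    intro x a ha
    have ha' := (tendsto_zero_iff_norm_tendsto_zero.1 ha).const_mul ‖x‖
    rw [mul_zero] at ha'
    refine squeeze_zero_norm (fun n => ?_) ha'
    exact (norm_mul_le (x n) (a n)).trans
      (mul_le_mul_of_nonneg_right (x.norm_apply_le n) (norm_nonneg _))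
  mul_right_mem := by
    intro x a ha
    have ha' := (tendsto_zero_iff_norm_tendsto_zero.1 ha).mul_const ‖x‖
    rw [zero_mul] at ha'
    refine squeeze_zero_norm (fun n => ?_) ha'
    exact (norm_mul_le (a n) (x n)).trans
      (mul_le_mul_of_nonneg_left (x.norm_apply_le n) (norm_nonneg _))
  star_mem := by
    intro a ha
    have := (continuous_star.tendsto (0 : A)).comp ha
    rw [star_zero] at this
    exact this
  isClosed := by
    refine isClosed_of_closure_subset fun x hx => ?_
    refine Metric.tendsto_atTop.2 fun ε hε => ?_
    obtain ⟨y, hy, hxy⟩ := Metric.mem_closure_iff.1 hx (ε / 2) (half_pos hε)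
    obtain ⟨N, hN⟩ := Metric.tendsto_atTop.1 hy (ε / 2) (half_pos hε)
    refine ⟨N, fun n hn => ?_⟩
    have h1 : dist (x n) (y n) ≤ dist x y := by
      rw [dist_eq_norm, dist_eq_norm]
      exact BddSeq.norm_apply_le (x - y) n
    calc dist (x n) 0 ≤ dist (x n) (y n) + dist (y n) 0 := dist_triangle _ _ _
      _ < ε / 2 + ε / 2 := add_lt_add (h1.trans_lt hxy) (hN n hn)
      _ = ε := add_halves ε

/-- The sequence algebra `A_∞ = ℓ^∞(A) / c_0(A)`. -/
abbrev SeqAlg : Type _ := (nullSeq A).QuotAlg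

/-- The constant sequence with value `a`. -/
def constSeq (a : A) : BddSeq A :=
  ⟨fun _ => a, memℓp_infty ⟨‖a‖, by rintro _ ⟨n, rfl⟩; exact le_rfl⟩⟩

/-- The embedding of `A` in `A_∞` by constant sequences. -/
def diag (a : A) : SeqAlg A := QuotAlg.mk (nullSeq A) (constSeq A a)

theorem star_diag (a : A) : star (diag A a) = diag A (star a) := rfl

/-- `A_∞ ∩ A'`, the elements of `A_∞` that commute with all constant sequences. -/
abbrev CentralSeq : NonUnitalStarSubalgebra ℂ (SeqAlg A) :=
  NonUnitalStarSubalgebra.centralizer ℂ (Set.range (diag A))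

variable {A} in
theorem CentralSeq.comm (x : CentralSeq A) (a : A) :
    diag A a * (x : SeqAlg A) = x * diag A a :=
  (NonUnitalStarSubalgebra.mem_centralizer_iff ℂ |>.1 x.2 _ ⟨a, rfl⟩).1

variable {A} in
theorem CentralSeq.mem_iff {x : SeqAlg A} :
    x ∈ CentralSeq A ↔ ∀ a, diag A a * x = x * diag A a := by
  refine ⟨fun h a => CentralSeq.comm ⟨x, h⟩ a, fun h => ?_⟩
  rw [NonUnitalStarSubalgebra.mem_centralizer_iff]
  rintro _ ⟨a, rfl⟩
  exact ⟨h a, by rw [star_diag]; exact h _⟩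

/-- `Ann(A)`, the annihilator of `A` in `A_∞ ∩ A'`. -/
def annihilator : ClosedStarIdeal (CentralSeq A) where
  carrier := {x | ∀ a : A, (x : SeqAlg A) * diag A a = 0}
  add_mem' := by
    intro x y hx hy a
    simp [add_mul, hx a, hy a]
  zero_mem' := by
    intro a
    simp
  smul_mem' := by
    intro c x hx a
    simp [smul_mul_assoc, hx a]
  mul_left_mem := by
    intro x y hy a
    simp [mul_assoc, hy a]
  mul_right_mem := by
    intro x y hy a
    have : ((y * x : CentralSeq A) : SeqAlg A) * diag A a = y * diag A a * x := by
      simp [mul_assoc, ← CentralSeq.comm x a]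
    rw [this, hy a, zero_mul]
  star_mem := by
    intro x hx a
    have h := congrArg star (hx (star a))
    rw [star_mul, star_diag, star_star, star_zero] at h
    rw [← CentralSeq.comm (star x) a]
    exact h
  isClosed := by
    have : {x : CentralSeq A | ∀ a : A, (x : SeqAlg A) * diag A a = 0} =
        ⋂ a : A, {x : CentralSeq A | (x : SeqAlg A) * diag A a = 0} := by
      ext; simp
    rw [this]
    exact isClosed_iInter fun a =>
      isClosed_eq (continuous_subtype_val.mul continuous_const) continuous_const

/-- The (corrected) central sequence algebra `F_∞(A) = (A_∞ ∩ A') / Ann(A)`. -/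
abbrev FInf : Type _ := (annihilator A).QuotAlg

variable {A}

/-- The coordinatewise action of an automorphism on `ℓ^∞(A)`. -/
def BddSeq.map (e : A ≃⋆ₐ[ℂ] A) : BddSeq A →⋆ₙₐ[ℂ] BddSeq A where
  toFun x := ⟨fun n => e (x n), memℓp_infty ⟨‖x‖, by
    rintro _ ⟨n, rfl⟩
    exact (NonUnitalStarAlgHom.norm_apply_le e (x n)).trans (x.norm_apply_le n)⟩⟩
  map_smul' c x := by ext n; exact map_smul e c (x n)
  map_zero' := by ext n; exact map_zero e
  map_add' x y := by ext n; exact map_add e (x n) (y n)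
  map_mul' x y := by ext n; exact map_mul e (x n) (y n)
  map_star' x := by ext n; exact map_star e (x n)

theorem BddSeq.map_constSeq (e : A ≃⋆ₐ[ℂ] A) (a : A) :
    BddSeq.map e (constSeq A a) = constSeq A (e a) := rfl

/-- The induced action of an automorphism on `A_∞`. -/
def SeqAlg.map (e : A ≃⋆ₐ[ℂ] A) : SeqAlg A →⋆ₙₐ[ℂ] SeqAlg A :=
  QuotAlg.map _ _ (BddSeq.map e) fun x hx => by
    have hx' : Filter.Tendsto (fun n => x n) Filter.atTop (𝓝 0) := hx
    have h := tendsto_zero_iff_norm_tendsto_zero.1 hx'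
    exact squeeze_zero_norm (fun n => NonUnitalStarAlgHom.norm_apply_le e (x n)) h

theorem SeqAlg.map_diag (e : A ≃⋆ₐ[ℂ] A) (a : A) : SeqAlg.map e (diag A a) = diag A (e a) := rfl

/-- The induced action of an automorphism on `A_∞ ∩ A'`. -/
def CentralSeq.map (e : A ≃⋆ₐ[ℂ] A) : CentralSeq A →⋆ₙₐ[ℂ] CentralSeq A :=
  NonUnitalStarAlgHom.codRestrict
    ((SeqAlg.map e).comp (NonUnitalStarSubalgebraClass.subtype (CentralSeq A))) (CentralSeq A)
    fun x => CentralSeq.mem_iff.2 fun a => by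
      have h := congrArg (SeqAlg.map e) (CentralSeq.comm x (e.symm a))
      rwa [map_mul, map_mul, SeqAlg.map_diag, StarAlgEquiv.apply_symm_apply] at h

/-- The induced action of an automorphism on `F_∞(A)`. -/
def FInf.map (e : A ≃⋆ₐ[ℂ] A) : FInf A →⋆ₙₐ[ℂ] FInf A :=
  QuotAlg.map _ _ (CentralSeq.map e) fun x hx a => by
    have hx' : ∀ a : A, (x : SeqAlg A) * diag A a = 0 := hx
    have h := congrArg (SeqAlg.map e) (hx' (e.symm a))
    rwa [map_mul, SeqAlg.map_diag, StarAlgEquiv.apply_symm_apply, map_zero] at h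

end Sequence

/-! ### Actions and Rokhlin dimension with commuting towers -/

/-- A continuous (that is, point-norm continuous) action of a group on a C⋆-algebra. -/
structure CStarAction (G : Type*) [Group G] [TopologicalSpace G]
    (A : Type*) [NonUnitalCStarAlgebra A] where
  aut : G →* (A ≃⋆ₐ[ℂ] A)
  continuous_orbit : ∀ a : A, Continuous fun g => aut g a

section Rokhlin

variable {G : Type*} [Group G] [TopologicalSpace G] [IsTopologicalGroup G] [CompactSpace G]
  {A : Type*} [NonUnitalCStarAlgebra A]

/-- `F_∞^{(α)}(A)`, the elements of `F_∞(A)` on which `G` acts continuously. -/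
def continuousPart (α : CStarAction G A) : Set (FInf A) :=
  {x | Continuous fun g => FInf.map (α.aut g) x}

/-- Left translation on `C(G)`: `(g • f)(x) = f (g⁻¹ x)`. -/
def translate (g : G) (f : C(G, ℂ)) : C(G, ℂ) :=
  f.comp ⟨fun x => g⁻¹ * x, continuous_const_mul _⟩

/-- Complete positivity: every amplification to `k × k` matrices maps positive elements, that is,
elements of the form `M⋆ M`, to positive elements. -/
def IsCompletelyPositive {R S : Type*} [NonUnitalRing R] [StarRing R] [Module ℂ R]
    [NonUnitalRing S] [StarRing S] [Module ℂ S] (φ : R →ₗ[ℂ] S) : Prop :=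
  ∀ (k : ℕ) (M : Matrix (Fin k) (Fin k) R), ∃ N : Matrix (Fin k) (Fin k) S,
    (M.conjTranspose * M).map φ = N.conjTranspose * N

/-- `dim_Rok^c(α) ≤ d`: there are `d + 1` equivariant completely positive contractive order zero
maps `C(G) → F_∞^{(α)}(A)` with pairwise commuting ranges, and with the images of `1` adding up to
the unit of `F_∞(A)`. -/
def RokhlinDimCLE (α : CStarAction G A) (d : ℕ) : Prop :=
  ∃ φ : Fin (d + 1) → (C(G, ℂ) →ₗ[ℂ] FInf A),
    (∀ i f, φ i f ∈ continuousPart α) ∧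
    (∀ i, IsCompletelyPositive (φ i)) ∧
    (∀ i f, ‖φ i f‖ ≤ ‖f‖) ∧
    (∀ i (f h : C(G, ℂ)), f * h = 0 → φ i f * φ i h = 0) ∧
    (∀ i g f, φ i (translate g f) = FInf.map (α.aut g) (φ i f)) ∧
    (∀ i j, i ≠ j → ∀ f h, φ i f * φ j h = φ j h * φ i f) ∧
    ∀ x : FInf A, (∑ i, φ i 1) * x = x ∧ x * (∑ i, φ i 1) = x

/-- The Rokhlin dimension with commuting towers `dim_Rok^c(α)`: the least `d` as above, and `∞` if
there is none. -/
def rokhlinDimC (α : CStarAction G A) : ℕ∞ :=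
  sInf ((fun d : ℕ => (d : ℕ∞)) '' {d | RokhlinDimCLE α d})

end Rokhlin

/-! ### The maximal tensor product -/

section MaxTensor

variable (A B : Type*) [NonUnitalCStarAlgebra A] [NonUnitalCStarAlgebra B]

/-- The algebraic tensor product over `ℂ`, a star algebra. It is a type synonym that carries the
maximal C⋆-seminorm. -/
def AlgTensor : Type _ := A ⊗[ℂ] B

namespace AlgTensor

instance : NonUnitalRing (AlgTensor A B) := inferInstanceAs (NonUnitalRing (A ⊗[ℂ] B))
instance : Module ℂ (AlgTensor A B) := inferInstanceAs (Module ℂ (A ⊗[ℂ] B))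
instance : IsScalarTower ℂ (AlgTensor A B) (AlgTensor A B) :=
  inferInstanceAs (IsScalarTower ℂ (A ⊗[ℂ] B) (A ⊗[ℂ] B))
instance : SMulCommClass ℂ (AlgTensor A B) (AlgTensor A B) :=
  inferInstanceAs (SMulCommClass ℂ (A ⊗[ℂ] B) (A ⊗[ℂ] B))
instance : StarAddMonoid (AlgTensor A B) where
  __ := (inferInstanceAs (InvolutiveStar (A ⊗[ℂ] B)) : InvolutiveStar (AlgTensor A B))
  star_add := star_add (R := A ⊗[ℂ] B)
instance : StarModule ℂ (AlgTensor A B) := inferInstanceAs (StarModule ℂ (A ⊗[ℂ] B))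

variable {A B}

/-- Elementary tensors. -/
def tmul (a : A) (b : B) : AlgTensor A B := a ⊗ₜ[ℂ] b

theorem tmul_mul (a a' : A) (b b' : B) :
    (tmul a b : AlgTensor A B) * tmul a' b' = tmul (a * a') (b * b') :=
  Algebra.TensorProduct.tmul_mul_tmul a a' b b'

theorem star_tmul (a : A) (b : B) : star (tmul a b : AlgTensor A B) = tmul (star a) (star b) :=
  TensorProduct.star_tmul a b

theorem add_tmul (a a' : A) (b : B) :
    (tmul (a + a') b : AlgTensor A B) = tmul a b + tmul a' b := TensorProduct.add_tmul a a' b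

theorem tmul_add (a : A) (b b' : B) :
    (tmul a (b + b') : AlgTensor A B) = tmul a b + tmul a b' := TensorProduct.tmul_add a b b'

theorem induction {p : AlgTensor A B → Prop} (x : AlgTensor A B) (h0 : p 0)
    (h1 : ∀ a b, p (tmul a b)) (h2 : ∀ x y, p x → p y → p (x + y)) : p x :=
  TensorProduct.induction_on (motive := p) x h0 h1 h2

instance : StarRing (AlgTensor A B) where
  star_mul x y := by
    induction x using induction with
    | h0 => simp
    | h1 a b =>
      induction y using induction with
      | h0 => simp
      | h1 a' b' => simp only [tmul_mul, star_tmul, star_mul]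
      | h2 x y hx hy => rw [mul_add, star_add, hx, hy, star_add, add_mul]
    | h2 x x' hx hx' => rw [add_mul, star_add, hx, hx', star_add, mul_add]
  star_add := star_add

/-- C⋆-seminorms on the algebraic tensor product. The last bound holds automatically for a
C⋆-seminorm; it is recorded so that the supremum of all of them is visibly finite. -/
structure IsCStarSeminorm (p : Seminorm ℂ (AlgTensor A B)) : Prop where
  mul_le : ∀ x y, p (x * y) ≤ p x * p y
  star_mul_self : ∀ x, p (star x * x) = p x * p x
  tmul_le : ∀ a b, p (tmul a b) ≤ ‖a‖ * ‖b‖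

variable (A B) in
/-- The type of all C⋆-seminorms on the algebraic tensor product. -/
def CStarSeminorms : Type _ := {p : Seminorm ℂ (AlgTensor A B) // IsCStarSeminorm p}

instance : Nonempty (CStarSeminorms A B) :=
  ⟨⟨0, by
    refine ⟨fun _ _ => ?_, fun _ => ?_, fun _ _ => ?_⟩
    · simp
    · simp
    · simpa using by positivity⟩⟩

theorem bddAbove (x : AlgTensor A B) :
    BddAbove (Set.range fun p : CStarSeminorms A B => p.1 x) := by
  induction x using induction with
  | h0 => exact ⟨0, by rintro _ ⟨p, rfl⟩; simp⟩
  | h1 a b => exact ⟨‖a‖ * ‖b‖, by rintro _ ⟨p, rfl⟩; exact p.2.tmul_le a b⟩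
  | h2 x y hx hy =>
    obtain ⟨C, hC⟩ := hx
    obtain ⟨D, hD⟩ := hy
    refine ⟨C + D, ?_⟩
    rintro _ ⟨p, rfl⟩
    exact (map_add_le_add p.1 x y).trans (add_le_add (hC ⟨p, rfl⟩) (hD ⟨p, rfl⟩))

/-- The maximal C⋆-seminorm: the supremum of all C⋆-seminorms. -/
def maxNorm (x : AlgTensor A B) : ℝ := ⨆ p : CStarSeminorms A B, p.1 x

theorem le_maxNorm (p : CStarSeminorms A B) (x : AlgTensor A B) : p.1 x ≤ maxNorm x :=
  le_ciSup (bddAbove x) p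

theorem maxNorm_nonneg (x : AlgTensor A B) : 0 ≤ maxNorm x :=
  Real.iSup_nonneg fun p => apply_nonneg p.1 x

theorem IsCStarSeminorm.star_le {p : Seminorm ℂ (AlgTensor A B)} (hp : IsCStarSeminorm p)
    (x : AlgTensor A B) : p x ≤ p (star x) := by
  rcases (apply_nonneg p x).eq_or_lt with h | h
  · rw [← h]; exact apply_nonneg p _
  · have := hp.mul_le (star x) x
    rw [hp.star_mul_self] at this
    exact le_of_mul_le_mul_right this h

theorem maxNorm_tmul_le (a : A) (b : B) : maxNorm (tmul a b) ≤ ‖a‖ * ‖b‖ :=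
  ciSup_le fun p => p.2.tmul_le a b

instance : NonUnitalSeminormedRing (AlgTensor A B) where
  __ := (AddGroupSeminorm.toSeminormedAddCommGroup
    { toFun := maxNorm
      map_zero' := by simp [maxNorm]
      add_le' := fun x y => ciSup_le fun p =>
        (map_add_le_add p.1 x y).trans (add_le_add (le_maxNorm p x) (le_maxNorm p y))
      neg' := fun x => by simp [maxNorm] } : SeminormedAddCommGroup (AlgTensor A B))
  __ := (inferInstance : NonUnitalRing (AlgTensor A B))
  norm_mul_le x y := ciSup_le fun p => (p.2.mul_le x y).trans
    (mul_le_mul (le_maxNorm p x) (le_maxNorm p y) (apply_nonneg p.1 y) (maxNorm_nonneg x))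

theorem norm_def (x : AlgTensor A B) : ‖x‖ = maxNorm x := rfl

instance : NormedSpace ℂ (AlgTensor A B) where
  norm_smul_le c x := ciSup_le fun p => by
    rw [map_smul_eq_mul]
    exact mul_le_mul_of_nonneg_left (le_maxNorm p x) (norm_nonneg c)

theorem norm_star (x : AlgTensor A B) : ‖star x‖ = ‖x‖ := by
  refine le_antisymm (ciSup_le fun p => ?_) (ciSup_le fun p => ?_)
  · have := p.2.star_le (star x)
    rw [star_star] at this
    exact this.trans (le_maxNorm p x)
  · exact (p.2.star_le x).trans (le_maxNorm p (star x))

theorem norm_mul_self_le (x : AlgTensor A B) : ‖x‖ * ‖x‖ ≤ ‖star x * x‖ := by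
  have h : ‖x‖ ≤ √‖star x * x‖ := ciSup_le fun p => by
    refine Real.le_sqrt_of_sq_le ?_
    rw [sq, ← p.2.star_mul_self]
    exact le_maxNorm p _
  calc ‖x‖ * ‖x‖ ≤ √‖star x * x‖ * √‖star x * x‖ := by gcongr
    _ = _ := Real.mul_self_sqrt (norm_nonneg _)

end AlgTensor

/-- The maximal tensor product `A ⊗_max B`: the completion of the algebraic tensor product in the
maximal C⋆-norm. -/
def MaxTensor : Type _ := UniformSpace.Completion (AlgTensor A B)

namespace MaxTensor

open UniformSpace

instance : NormedAddCommGroup (MaxTensor A B) :=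
  inferInstanceAs (NormedAddCommGroup (Completion (AlgTensor A B)))
instance : NormedSpace ℂ (MaxTensor A B) :=
  inferInstanceAs (NormedSpace ℂ (Completion (AlgTensor A B)))
instance : CompleteSpace (MaxTensor A B) :=
  inferInstanceAs (CompleteSpace (Completion (AlgTensor A B)))

variable {A B}

/-- The canonical map from the algebraic tensor product to its completion. -/
def of : AlgTensor A B →ₗᵢ[ℂ] MaxTensor A B := Completion.toComplₗᵢ

theorem denseInducing_of : IsDenseInducing (of : AlgTensor A B → MaxTensor A B) :=
  Completion.isDenseInducing_coe

theorem closed_induction {p : MaxTensor A B → Prop} (x : MaxTensor A B)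
    (hp : IsClosed {x | p x}) (h : ∀ y, p (of y)) : p x := Completion.induction_on x hp h

instance : Mul (MaxTensor A B) where
  mul x y := (denseInducing_of.prodMap denseInducing_of).extend
    (fun q : AlgTensor A B × AlgTensor A B => of (q.1 * q.2)) (x, y)

theorem of_mul (x y : AlgTensor A B) : (of (x * y) : MaxTensor A B) = of x * of y :=
  ((denseInducing_of.prodMap denseInducing_of).extend_eq
    (of.continuous.comp continuous_mul) (x, y)).symm

instance : ContinuousMul (MaxTensor A B) where
  continuous_mul := by
    let m : AlgTensor A B →+ AlgTensor A B →+ MaxTensor A B :=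
      (AddMonoidHom.mul : AlgTensor A B →+ AlgTensor A B →+ AlgTensor A B).compr₂
        (of : AlgTensor A B →ₗᵢ[ℂ] MaxTensor A B).toLinearMap.toAddMonoidHom
    have : Continuous fun p : AlgTensor A B × AlgTensor A B => m p.1 p.2 :=
      of.continuous.comp continuous_mul
    have di : IsDenseInducing
        ((of : AlgTensor A B →ₗᵢ[ℂ] MaxTensor A B).toLinearMap.toAddMonoidHom) := denseInducing_of
    exact (di.extend_Z_bilin di this :)

theorem mul_assoc' (x y z : MaxTensor A B) : x * y * z = x * (y * z) := by
  induction x using closed_induction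
  · exact isClosed_eq ((continuous_id.mul continuous_const).mul continuous_const)
      (continuous_id.mul continuous_const)
  rename_i x
  induction y using closed_induction
  · exact isClosed_eq ((continuous_const.mul continuous_id).mul continuous_const)
      (continuous_const.mul (continuous_id.mul continuous_const))
  rename_i y
  induction z using closed_induction
  · exact isClosed_eq (continuous_const.mul continuous_id)
      (continuous_const.mul (continuous_const.mul continuous_id))
  rename_i z
  rw [← of_mul, ← of_mul, ← of_mul, ← of_mul, mul_assoc]

theorem mul_add' (x y z : MaxTensor A B) : x * (y + z) = x * y + x * z := by
  induction x using closed_induction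
  · exact isClosed_eq (continuous_id.mul continuous_const)
      ((continuous_id.mul continuous_const).add (continuous_id.mul continuous_const))
  rename_i x
  induction y using closed_induction
  · exact isClosed_eq (continuous_const.mul (continuous_id.add continuous_const))
      ((continuous_const.mul continuous_id).add continuous_const)
  rename_i y
  induction z using closed_induction
  · exact isClosed_eq (continuous_const.mul (continuous_const.add continuous_id))
      (continuous_const.add (continuous_const.mul continuous_id))
  rename_i z
  rw [← map_add, ← of_mul, ← of_mul, ← of_mul, mul_add, map_add]

theorem add_mul' (x y z : MaxTensor A B) : (x + y) * z = x * z + y * z := by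
  induction x using closed_induction
  · exact isClosed_eq ((continuous_id.add continuous_const).mul continuous_const)
      ((continuous_id.mul continuous_const).add continuous_const)
  rename_i x
  induction y using closed_induction
  · exact isClosed_eq ((continuous_const.add continuous_id).mul continuous_const)
      (continuous_const.add (continuous_id.mul continuous_const))
  rename_i y
  induction z using closed_induction
  · exact isClosed_eq (continuous_const.mul continuous_id)
      ((continuous_const.mul continuous_id).add (continuous_const.mul continuous_id))
  rename_i z
  rw [← map_add, ← of_mul, ← of_mul, ← of_mul, add_mul, map_add]

theorem zero_mul' (x : MaxTensor A B) : 0 * x = 0 := by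
  simpa using add_mul' 0 0 x

theorem mul_zero' (x : MaxTensor A B) : x * 0 = 0 := by
  simpa using mul_add' x 0 0

instance : NonUnitalRing (MaxTensor A B) where
  __ := (inferInstance : AddCommGroup (MaxTensor A B))
  zero_mul := zero_mul'
  mul_zero := mul_zero'
  mul_assoc := mul_assoc'
  left_distrib := mul_add'
  right_distrib := add_mul'

theorem uniformContinuous_star :
    UniformContinuous (star : AlgTensor A B → AlgTensor A B) :=
  (AddMonoidHomClass.isometry_of_norm (starAddEquiv : AlgTensor A B ≃+ AlgTensor A B)
    AlgTensor.norm_star).uniformContinuous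

instance : Star (MaxTensor A B) where
  star := Completion.map (star : AlgTensor A B → AlgTensor A B)

theorem of_star (x : AlgTensor A B) : (of (star x) : MaxTensor A B) = star (of x) :=
  (Completion.map_coe uniformContinuous_star x).symm

instance : ContinuousStar (MaxTensor A B) where
  continuous_star := Completion.continuous_map

instance : StarRing (MaxTensor A B) where
  star_involutive x := by
    induction x using closed_induction
    · exact isClosed_eq (continuous_star.comp continuous_star) continuous_id
    rename_i x
    rw [← of_star, ← of_star, star_star]
  star_mul x y := by
    induction x using closed_induction
    · exact isClosed_eq (by fun_prop) (by fun_prop)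
    rename_i x
    induction y using closed_induction
    · exact isClosed_eq (by fun_prop) (by fun_prop)
    rename_i y
    simp only [← of_mul, ← of_star, star_mul]
  star_add x y := by
    induction x using closed_induction
    · exact isClosed_eq (by fun_prop) (by fun_prop)
    rename_i x
    induction y using closed_induction
    · exact isClosed_eq (by fun_prop) (by fun_prop)
    rename_i y
    simp only [← map_add, ← of_star, star_add]

instance : NonUnitalNormedRing (MaxTensor A B) where
  __ := (inferInstance : NormedAddCommGroup (MaxTensor A B))
  __ := (inferInstance : NonUnitalRing (MaxTensor A B))
  norm_mul_le x y := by
    induction x using closed_induction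
    · exact isClosed_le (by fun_prop) (by fun_prop)
    rename_i x
    induction y using closed_induction
    · exact isClosed_le (by fun_prop) (by fun_prop)
    rename_i y
    rw [← of_mul, of.norm_map, of.norm_map, of.norm_map]
    exact norm_mul_le x y

instance : NonUnitalCStarAlgebra (MaxTensor A B) where
  norm_mul_self_le x := by
    induction x using closed_induction
    · exact isClosed_le (by fun_prop) (by fun_prop)
    rename_i x
    rw [← of_star, ← of_mul, of.norm_map, of.norm_map]
    exact AlgTensor.norm_mul_self_le x
  smul_assoc c x y := by
    change c • x * y = c • (x * y)
    induction x using closed_induction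
    · exact isClosed_eq ((continuous_const_smul c).mul continuous_const)
        ((continuous_id.mul continuous_const).const_smul c)
    rename_i x
    induction y using closed_induction
    · exact isClosed_eq (continuous_const.mul continuous_id)
        ((continuous_const.mul continuous_id).const_smul c)
    rename_i y
    rw [← map_smul, ← of_mul, ← of_mul, ← map_smul, smul_mul_assoc]
  smul_comm c x y := by
    change c • (x * y) = x * c • y
    induction x using closed_induction
    · exact isClosed_eq ((continuous_id.mul continuous_const).const_smul c)
        (continuous_id.mul continuous_const)
    rename_i x
    induction y using closed_induction
    · exact isClosed_eq ((continuous_const.mul continuous_id).const_smul c)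
        (continuous_const.mul (continuous_const_smul c))
    rename_i y
    rw [← map_smul, ← of_mul, ← of_mul, ← map_smul, mul_smul_comm]
  star_smul c x := by
    induction x using closed_induction
    · exact isClosed_eq (continuous_star.comp (continuous_const_smul c))
        (continuous_star.const_smul (star c))
    rename_i x
    rw [← map_smul, ← of_star, ← of_star, star_smul, map_smul]

/-- The elementary tensor `a ⊗ b` in `A ⊗_max B`. -/
def tmul (a : A) (b : B) : MaxTensor A B := of (AlgTensor.tmul a b)

theorem norm_tmul_le (a : A) (b : B) : ‖tmul a b‖ ≤ ‖a‖ * ‖b‖ := by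
  rw [tmul, of.norm_map]
  exact AlgTensor.maxNorm_tmul_le a b

end MaxTensor

end MaxTensor

/-! ### Functoriality and the product action -/

section Product

variable {A B A' B' A'' B'' : Type*} [NonUnitalCStarAlgebra A] [NonUnitalCStarAlgebra B]
  [NonUnitalCStarAlgebra A'] [NonUnitalCStarAlgebra B']
  [NonUnitalCStarAlgebra A''] [NonUnitalCStarAlgebra B'']

/-- The tensor product of two star homomorphisms, on the algebraic tensor product. -/
def AlgTensor.map (φ : A →⋆ₙₐ[ℂ] A') (ψ : B →⋆ₙₐ[ℂ] B') :
    AlgTensor A B →⋆ₙₐ[ℂ] AlgTensor A' B' :=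
  let L : AlgTensor A B →ₗ[ℂ] AlgTensor A' B' :=
    TensorProduct.map (φ : A →ₗ[ℂ] A') (ψ : B →ₗ[ℂ] B')
  have hL : ∀ a b, L (AlgTensor.tmul a b) = AlgTensor.tmul (φ a) (ψ b) := fun _ _ => rfl
  { toFun := L
    map_smul' := map_smul L
    map_zero' := map_zero L
    map_add' := map_add L
    map_mul' := fun x y => by
      induction x using AlgTensor.induction with
      | h0 => simp
      | h1 a b =>
        induction y using AlgTensor.induction with
        | h0 => simp
        | h1 a' b' => simp only [AlgTensor.tmul_mul, hL, map_mul]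
        | h2 x y hx hy => rw [mul_add, map_add, hx, hy, map_add, mul_add]
      | h2 x x' hx hx' => rw [add_mul, map_add, hx, hx', map_add, add_mul]
    map_star' := fun x => by
      induction x using AlgTensor.induction with
      | h0 => simp
      | h1 a b => simp only [AlgTensor.star_tmul, hL, map_star]
      | h2 x y hx hy => rw [star_add, map_add, hx, hy, map_add, star_add] }

theorem AlgTensor.map_tmul (φ : A →⋆ₙₐ[ℂ] A') (ψ : B →⋆ₙₐ[ℂ] B') (a : A) (b : B) :
    AlgTensor.map φ ψ (AlgTensor.tmul a b) = AlgTensor.tmul (φ a) (ψ b) := rfl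

theorem AlgTensor.norm_map_le (φ : A →⋆ₙₐ[ℂ] A') (ψ : B →⋆ₙₐ[ℂ] B') (x : AlgTensor A B) :
    ‖AlgTensor.map φ ψ x‖ ≤ ‖x‖ := by
  refine ciSup_le fun p => ?_
  let L : AlgTensor A B →ₗ[ℂ] AlgTensor A' B' :=
    { toFun := AlgTensor.map φ ψ
      map_add' := map_add (AlgTensor.map φ ψ)
      map_smul' := map_smul (AlgTensor.map φ ψ) }
  have hq : AlgTensor.IsCStarSeminorm (p.1.comp L) := by
    refine ⟨fun x y => ?_, fun x => ?_, fun a b => ?_⟩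
    · change p.1 (AlgTensor.map φ ψ (x * y)) ≤ _
      rw [map_mul]
      exact p.2.mul_le _ _
    · change p.1 (AlgTensor.map φ ψ (star x * x)) = _
      rw [map_mul, map_star]
      exact p.2.star_mul_self _
    · change p.1 (AlgTensor.tmul (φ a) (ψ b)) ≤ _
      exact (p.2.tmul_le _ _).trans (mul_le_mul (NonUnitalStarAlgHom.norm_apply_le φ a)
        (NonUnitalStarAlgHom.norm_apply_le ψ b) (norm_nonneg _) (norm_nonneg _))
  exact AlgTensor.le_maxNorm ⟨p.1.comp L, hq⟩ x

theorem AlgTensor.uniformContinuous_map (φ : A →⋆ₙₐ[ℂ] A') (ψ : B →⋆ₙₐ[ℂ] B') :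
    UniformContinuous (AlgTensor.map φ ψ) :=
  (AddMonoidHomClass.lipschitz_of_bound (AlgTensor.map φ ψ) 1
    (fun x => by simpa using AlgTensor.norm_map_le φ ψ x)).uniformContinuous

namespace MaxTensor

/-- The underlying function of `φ ⊗ ψ` on the maximal tensor product, the continuous extension of
the algebraic `φ ⊗ ψ`. -/
def mapFun (φ : A →⋆ₙₐ[ℂ] A') (ψ : B →⋆ₙₐ[ℂ] B') : MaxTensor A B → MaxTensor A' B' :=
  UniformSpace.Completion.map (AlgTensor.map φ ψ)

theorem mapFun_of (φ : A →⋆ₙₐ[ℂ] A') (ψ : B →⋆ₙₐ[ℂ] B') (x : AlgTensor A B) :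
    mapFun φ ψ (of x) = of (AlgTensor.map φ ψ x) :=
  UniformSpace.Completion.map_coe (AlgTensor.uniformContinuous_map φ ψ) x

@[fun_prop]
theorem continuous_mapFun (φ : A →⋆ₙₐ[ℂ] A') (ψ : B →⋆ₙₐ[ℂ] B') : Continuous (mapFun φ ψ) :=
  UniformSpace.Completion.continuous_map

/-- The star homomorphism `φ ⊗ ψ : A ⊗_max B → A' ⊗_max B'`. -/
def map (φ : A →⋆ₙₐ[ℂ] A') (ψ : B →⋆ₙₐ[ℂ] B') : MaxTensor A B →⋆ₙₐ[ℂ] MaxTensor A' B' where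
  toFun := mapFun φ ψ
  map_smul' c x := by
    induction x using closed_induction
    · exact isClosed_eq ((continuous_mapFun φ ψ).comp (continuous_const_smul c))
        ((continuous_mapFun φ ψ).const_smul c)
    rename_i x
    rw [← map_smul, mapFun_of, mapFun_of, map_smul, map_smul]
    rfl
  map_zero' := by
    rw [← map_zero of, mapFun_of, map_zero, map_zero]
  map_add' x y := by
    induction x using closed_induction
    · exact isClosed_eq (by fun_prop) (by fun_prop)
    rename_i x
    induction y using closed_induction
    · exact isClosed_eq (by fun_prop) (by fun_prop)
    rename_i y
    simp only [← map_add of, mapFun_of, map_add (AlgTensor.map φ ψ)]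
  map_mul' x y := by
    induction x using closed_induction
    · exact isClosed_eq (by fun_prop) (by fun_prop)
    rename_i x
    induction y using closed_induction
    · exact isClosed_eq (by fun_prop) (by fun_prop)
    rename_i y
    simp only [← of_mul, mapFun_of, map_mul (AlgTensor.map φ ψ)]
  map_star' x := by
    induction x using closed_induction
    · exact isClosed_eq (by fun_prop) (by fun_prop)
    rename_i x
    simp only [← of_star, mapFun_of, map_star (AlgTensor.map φ ψ)]

theorem map_tmul (φ : A →⋆ₙₐ[ℂ] A') (ψ : B →⋆ₙₐ[ℂ] B') (a : A) (b : B) :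
    map φ ψ (tmul a b) = tmul (φ a) (ψ b) := mapFun_of φ ψ _

theorem ext {f g : MaxTensor A B → A'} (hf : Continuous f) (hg : Continuous g)
    (hf' : ∀ x y, f (x + y) = f x + f y) (hg' : ∀ x y, g (x + y) = g x + g y)
    (h : ∀ a b, f (tmul a b) = g (tmul a b)) : f = g := by
  have hf0 : f 0 = 0 := by simpa using hf' 0 0
  have hg0 : g 0 = 0 := by simpa using hg' 0 0
  funext x
  induction x using closed_induction
  · exact isClosed_eq hf hg
  rename_i x
  induction x using AlgTensor.induction with
  | h0 => rw [map_zero, hf0, hg0]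
  | h1 a b => exact h a b
  | h2 x y hx hy => rw [map_add, hf', hg', hx, hy]

theorem map_id_apply {φ : A →⋆ₙₐ[ℂ] A} {ψ : B →⋆ₙₐ[ℂ] B} (hφ : ∀ a, φ a = a) (hψ : ∀ b, ψ b = b)
    (x : MaxTensor A B) : map φ ψ x = x :=
  congrFun (ext (f := map φ ψ) (g := id) (continuous_mapFun φ ψ) continuous_id
    (map_add (map φ ψ)) (fun _ _ => rfl) (fun a b => by rw [map_tmul, hφ, hψ]; rfl)) x

theorem map_comp_apply {φ : A →⋆ₙₐ[ℂ] A'} {ψ : B →⋆ₙₐ[ℂ] B'} {φ' : A' →⋆ₙₐ[ℂ] A''}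
    {ψ' : B' →⋆ₙₐ[ℂ] B''} {φ'' : A →⋆ₙₐ[ℂ] A''} {ψ'' : B →⋆ₙₐ[ℂ] B''}
    (hφ : ∀ a, φ' (φ a) = φ'' a) (hψ : ∀ b, ψ' (ψ b) = ψ'' b) (x : MaxTensor A B) :
    map φ' ψ' (map φ ψ x) = map φ'' ψ'' x :=
  congrFun (ext (f := fun x => map φ' ψ' (map φ ψ x)) (g := map φ'' ψ'')
    ((continuous_mapFun φ' ψ').comp (continuous_mapFun φ ψ)) (continuous_mapFun φ'' ψ'')
    (fun x y => by rw [map_add, map_add]) (map_add (map φ'' ψ''))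
    (fun a b => by simp only [map_tmul, hφ, hψ])) x

/-- The tensor product of two automorphisms. -/
def autMap (e : A ≃⋆ₐ[ℂ] A) (f : B ≃⋆ₐ[ℂ] B) : MaxTensor A B ≃⋆ₐ[ℂ] MaxTensor A B :=
  { toFun := map (e : A →⋆ₙₐ[ℂ] A) (f : B →⋆ₙₐ[ℂ] B)
    invFun := map (e.symm : A →⋆ₙₐ[ℂ] A) (f.symm : B →⋆ₙₐ[ℂ] B)
    left_inv := fun x => by
      rw [map_comp_apply (φ'' := NonUnitalStarAlgHom.id ℂ A) (ψ'' := NonUnitalStarAlgHom.id ℂ B)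
        (fun a => e.symm_apply_apply a) (fun b => f.symm_apply_apply b)]
      exact map_id_apply (fun _ => rfl) (fun _ => rfl) x
    right_inv := fun x => by
      rw [map_comp_apply (φ'' := NonUnitalStarAlgHom.id ℂ A) (ψ'' := NonUnitalStarAlgHom.id ℂ B)
        (fun a => e.apply_symm_apply a) (fun b => f.apply_symm_apply b)]
      exact map_id_apply (fun _ => rfl) (fun _ => rfl) x
    map_mul' := map_mul _
    map_add' := map_add _
    map_star' := map_star _
    map_smul' := map_smul _ }

theorem autMap_tmul (e : A ≃⋆ₐ[ℂ] A) (f : B ≃⋆ₐ[ℂ] B) (a : A) (b : B) :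
    autMap e f (tmul a b) = tmul (e a) (f b) := map_tmul _ _ a b

end MaxTensor

theorem MaxTensor.continuous_tmul :
    Continuous fun q : A × B => MaxTensor.tmul q.1 q.2 := by
  let L : A →ₗ[ℂ] B →ₗ[ℂ] MaxTensor A B :=
    LinearMap.mk₂ ℂ (fun a b => MaxTensor.tmul a b)
      (fun a a' b => by rw [tmul, AlgTensor.add_tmul, map_add]; rfl)
      (fun c a b => map_smul MaxTensor.of c (AlgTensor.tmul a b))
      (fun a b b' => by rw [tmul, AlgTensor.tmul_add, map_add]; rfl)
      (fun c a b => by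
        rw [tmul, tmul, ← map_smul]
        exact congrArg _ (TensorProduct.tmul_smul c a b))
  exact (L.mkContinuous₂ 1 fun a b => by
    rw [one_mul]; exact MaxTensor.norm_tmul_le a b).continuous₂

variable {G H : Type*} [Group G] [TopologicalSpace G] [Group H] [TopologicalSpace H]

/-- The action `(g, h) ↦ α_g ⊗ β_h` of `G × H` on `A ⊗_max B`. -/
def CStarAction.prod (α : CStarAction G A) (β : CStarAction H B) :
    CStarAction (G × H) (MaxTensor A B) where
  aut :=
    { toFun := fun q => MaxTensor.autMap (α.aut q.1) (β.aut q.2)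
      map_one' := by
        ext x
        exact MaxTensor.map_id_apply (fun a => by simp) (fun b => by simp) x
      map_mul' := fun q r => by
        ext x
        exact (MaxTensor.map_comp_apply (fun a => by simp) (fun b => by simp) x).symm }
  continuous_orbit x := by
    have key : ∀ y : AlgTensor A B, Continuous fun q : G × H =>
        MaxTensor.autMap (α.aut q.1) (β.aut q.2) (MaxTensor.of y) := fun y => by
      induction y using AlgTensor.induction with
      | h0 => simpa using continuous_const
      | h1 a b =>
        have : Continuous fun q : G × H => (α.aut q.1 a, β.aut q.2 b) :=
          ((α.continuous_orbit a).comp continuous_fst).prodMk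
            ((β.continuous_orbit b).comp continuous_snd)
        refine (MaxTensor.continuous_tmul.comp this).congr fun q => ?_
        exact (MaxTensor.autMap_tmul _ _ a b).symm
      | h2 y z hy hz =>
        refine (hy.add hz).congr fun q => ?_
        rw [map_add, map_add]
        rfl
    refine continuous_of_uniform_approx_of_continuous fun u hu => ?_
    obtain ⟨ε, hε, hu⟩ := Metric.mem_uniformity_dist.1 hu
    obtain ⟨y, hy⟩ := MaxTensor.denseInducing_of.dense.exists_dist_lt x hε
    refine ⟨_, key y, fun q => hu ?_⟩
    rw [dist_eq_norm] at hy ⊢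
    change ‖MaxTensor.autMap (α.aut q.1) (β.aut q.2) x - _‖ < ε
    rw [← map_sub]
    exact (NonUnitalStarAlgHom.norm_apply_le _ _).trans_lt hy

end Product

end CRokhlin

end

/-!
# Rokhlin dimension with commuting towers of a product action

Let `φ₀, …, φ_a` be commuting towers for the action of `G` on `A`, and `ψ₀, …, ψ_b` commuting towers
for the action of `H` on `B`. Tensoring representing sequences coordinatewise gives maps
`ξ ↦ ξ ⊗ 1` and `η ↦ 1 ⊗ η` from `F_∞(A)` and `F_∞(B)` to `F_∞(A ⊗_max B)` with commuting ranges
(`FInf.tmul`). They are unital because a separable C⋆-algebra has a sequential approximate unit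
(`FInf.tmul_unit`).

An order zero map on `C(G)` satisfies `φ f φ h = φ (f h) φ 1` (`orderZero_mul`). In particular all
`φ_i f ⊗ 1` and `1 ⊗ ψ_j h` lie in one commutative unital C⋆-algebra `D ≅ C(Y)`, and at a point `y`
of `Y` they take the values `t_i f (x_i)` and `s_j h (z_j)` for weights `t_i, s_j ≥ 0` with
`∑ t_i = ∑ s_j = 1` and points `x_i ∈ G`, `z_j ∈ H`. So `Y` maps to the product of two joins, of
`a + 1` copies of `G` and `b + 1` copies of `H`, and it remains to map this product equivariantly to
the join of `a + b + 1` copies of `G × H`.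

This is done by the staircase triangulation of a product of two simplices. Cut the unit interval into
consecutive intervals `I_0, …, I_a` of lengths `t_i`, and into intervals `J_0, …, J_b` of lengths
`s_j`, and let `λ_{ij}` be the length of `I_i ∩ J_j`. These weights add up to `1`, the weight `λ_{ij}`
vanishes if `t_i = 0` or `s_j = 0`, and two different weights with the same `i + j` are never both
positive (`overlap_mul_overlap`). Hence
`θ_k f = ∑_{i + j = k} λ_{ij} f (x_i, z_j)` is continuous on `Y`, and `θ_0, …, θ_{a+b}` are completely
positive contractive order zero maps `C(G × H) → C(Y)` with `∑ θ_k 1 = 1` (`PointTowers.tower`). They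
are equivariant since the weights are invariant and the points are translated
(`exists_product_towers`). Complete positivity is explicit: replacing `λ_{ij}` by its square root in
`θ_k` gives a map `θ_k'` with `θ_k (f⋆ h) = (θ_k' f)⋆ θ_k' h`.

The characters of `D` are available only if `F_∞` is a C⋆-algebra, which amounts to the C⋆-identity
for the quotient of a C⋆-algebra by a closed ideal (`ClosedStarIdeal.norm_mul_self_le`).
-/


open scoped TensorProduct ENNReal Topology ContDiff Manifold

noncomputable section

namespace CRokhlin

/-! ### The staircase subdivision of a product of simplices -/

/-- The partial sum `t₀ + ⋯ + t_{i-1}`. -/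
def cumSum {n : ℕ} (t : Fin n → ℝ) (i : ℕ) : ℝ := ∑ l with l.val < i, t l

section Overlap

variable {m n : ℕ} (t : Fin m → ℝ) (s : Fin n → ℝ)

theorem cumSum_zero : cumSum t 0 = 0 := by simp [cumSum]

theorem cumSum_self : cumSum t m = ∑ l, t l := by
  simp [cumSum]

theorem cumSum_succ (i : Fin m) : cumSum t (i + 1) = cumSum t i + t i := by
  have : ({l : Fin m | l.val < i.val + 1} : Finset (Fin m)) =
      insert i ({l : Fin m | l.val < i.val} : Finset (Fin m)) := by
    ext l
    simp only [Finset.mem_filter, Finset.mem_univ, true_and, Finset.mem_insert, Fin.ext_iff]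
    omega
  rw [cumSum, this, Finset.sum_insert (by simp), add_comm]
  rfl

variable {t s}

theorem cumSum_mono (ht : ∀ i, 0 ≤ t i) : Monotone (cumSum t) := fun i j hij =>
  Finset.sum_le_sum_of_subset_of_nonneg
    (fun l hl => by simp only [Finset.mem_filter, Finset.mem_univ, true_and] at hl ⊢; omega)
    fun l _ _ => ht l

variable (t s)

/-- The length of `[T_i, T_{i+1}] ∩ [S_j, S_{j+1}]`, where `T` and `S` are the partial sums of `t`
and `s`, written as the increment over `[S_j, S_{j+1}]` of the retraction of `ℝ` onto
`[T_i, T_{i+1}]`. -/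
def overlap (i : Fin m) (j : Fin n) : ℝ :=
  max (cumSum t i) (min (cumSum t (i + 1)) (cumSum s (j + 1))) -
    max (cumSum t i) (min (cumSum t (i + 1)) (cumSum s j))

variable {t s}

theorem overlap_nonneg (hs : ∀ j, 0 ≤ s j) (i : Fin m) (j : Fin n) : 0 ≤ overlap t s i j :=
  sub_nonneg.2 (max_le_max le_rfl (min_le_min le_rfl (cumSum_mono hs j.val.le_succ)))

theorem overlap_eq_zero_left {i : Fin m} (h : t i = 0) (j : Fin n) : overlap t s i j = 0 := by
  simp [overlap, cumSum_succ, h]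

theorem overlap_eq_zero_right (i : Fin m) {j : Fin n} (h : s j = 0) : overlap t s i j = 0 := by
  simp [overlap, cumSum_succ, h]

theorem sum_overlap (ht : ∀ i, 0 ≤ t i) (ht1 : ∑ i, t i = 1) (hs1 : ∑ j, s j = 1) :
    ∑ p : Fin m × Fin n, overlap t s p.1 p.2 = 1 := by
  have inner : ∀ i : Fin m, ∑ j : Fin n, overlap t s i j = t i := fun i => by
    have h := Finset.sum_range_sub
      (fun j => max (cumSum t i) (min (cumSum t (i + 1)) (cumSum s j))) n
    rw [← Fin.sum_univ_eq_sum_range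
      (fun j => max (cumSum t i) (min (cumSum t (i + 1)) (cumSum s (j + 1))) -
        max (cumSum t i) (min (cumSum t (i + 1)) (cumSum s j))), cumSum_zero, cumSum_self, hs1] at h
    have h0 : 0 ≤ cumSum t i := cumSum_zero t ▸ cumSum_mono ht (Nat.zero_le _)
    have h1 : cumSum t (i + 1) ≤ 1 := by
      rw [← ht1, ← cumSum_self]; exact cumSum_mono ht i.2
    have h2 : cumSum t i ≤ cumSum t (i + 1) := cumSum_mono ht i.val.le_succ
    calc ∑ j : Fin n, overlap t s i j = _ := h
      _ = t i := by
        rw [min_eq_left h1, max_eq_right h2, min_eq_right (h0.trans h2), max_eq_left h0,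
          cumSum_succ]
        ring
  rw [Fintype.sum_prod_type, ← ht1]
  exact Finset.sum_congr rfl fun i _ => inner i

theorem overlap_ne_zero (ht : ∀ i, 0 ≤ t i) (hs : ∀ j, 0 ≤ s j) {i : Fin m} {j : Fin n}
    (h : overlap t s i j ≠ 0) :
    cumSum t i < cumSum s (j + 1) ∧ cumSum s j < cumSum t (i + 1) := by
  have h2 : cumSum t i ≤ cumSum t (i + 1) := cumSum_mono ht i.val.le_succ
  have h3 : cumSum s j ≤ cumSum s (j + 1) := cumSum_mono hs j.val.le_succ
  constructor
  · by_contra! hc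
    refine h ?_
    rw [overlap, max_eq_left ((min_le_right _ _).trans hc),
      max_eq_left ((min_le_right _ _).trans (h3.trans hc)), sub_self]
  · by_contra! hc
    refine h ?_
    rw [overlap, min_eq_left (hc.trans h3), min_eq_left hc, sub_self]

/-- Intervals on a common antidiagonal cannot both overlap: if `i < i'` and `j' < j`, then
`[T_i, T_{i+1}]` lies to the left of `[T_{i'}, T_{i'+1}]`, while `[S_j, S_{j+1}]` lies to the right
of `[S_{j'}, S_{j'+1}]`. -/
theorem overlap_mul_overlap (ht : ∀ i, 0 ≤ t i) (hs : ∀ j, 0 ≤ s j) {p q : Fin m × Fin n}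
    (hpq : p ≠ q) (hsum : p.1.val + p.2.val = q.1.val + q.2.val) :
    overlap t s p.1 p.2 * overlap t s q.1 q.2 = 0 := by
  have key : ∀ {p q : Fin m × Fin n}, p.1.val < q.1.val → q.2.val < p.2.val →
      overlap t s p.1 p.2 * overlap t s q.1 q.2 = 0 := fun {p q} h1 h2 => by
    by_contra hne
    obtain ⟨hp, hq⟩ := mul_ne_zero_iff.1 hne
    have a := (overlap_ne_zero ht hs hp).2
    have b := (overlap_ne_zero ht hs hq).1
    have c : cumSum t (p.1 + 1) ≤ cumSum t q.1 := cumSum_mono ht h1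
    have d : cumSum s (q.2 + 1) ≤ cumSum s p.2 := cumSum_mono hs h2
    linarith
  rcases lt_trichotomy p.1.val q.1.val with h | h | h
  · exact key h (by omega)
  · exact (hpq (Prod.ext (Fin.ext h) (Fin.ext (by omega)))).elim
  · rw [mul_comm]; exact key h (by omega)

end Overlap

/-! ### Bounded bilinear maps that vanish on disjoint functions -/

/-- The retraction of `ℝ` onto the unit interval. -/
def ramp (a : ℝ) : ℝ := max 0 (min 1 a)

theorem ramp_of_nonpos {a : ℝ} (h : a ≤ 0) : ramp a = 0 := by
  rw [ramp, max_eq_left ((min_le_right _ _).trans h)]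

theorem ramp_of_one_le {a : ℝ} (h : 1 ≤ a) : ramp a = 1 := by
  rw [ramp, min_eq_left h, max_eq_right zero_le_one]

theorem ramp_mono : Monotone ramp := fun _ _ h => max_le_max le_rfl (min_le_min le_rfl h)

theorem continuous_ramp : Continuous ramp := by unfold ramp; fun_prop

theorem ramp_mem (a : ℝ) : 0 ≤ ramp a ∧ ramp a ≤ 1 :=
  ⟨le_max_left _ _, max_le zero_le_one (min_le_left _ _)⟩

theorem sum_ramp (n : ℕ) {a : ℝ} (h0 : 0 ≤ a) (hn : a ≤ n) :
    ∑ i ∈ Finset.range n, ramp (a - i) = a := by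
  have key : ∀ n : ℕ, ∑ i ∈ Finset.range n, ramp (a - i) = min (n : ℝ) a := fun n => by
    induction n with
    | zero => simp [h0]
    | succ n ih =>
      rw [Finset.sum_range_succ, ih]
      push_cast
      rcases le_total a n with h | h
      · rw [ramp_of_nonpos (by linarith), min_eq_right h, min_eq_right (by linarith), add_zero]
      · rcases le_total a (n + 1) with h' | h'
        · rw [ramp, min_eq_left h, min_eq_right h', min_eq_right (by linarith),
            max_eq_right (by linarith)]
          ring
        · rw [ramp_of_one_le (by linarith), min_eq_left h, min_eq_left h']
  rw [key, min_eq_right hn]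

section Disjoint

variable {X : Type*} [TopologicalSpace X]
  {E : Type*} [NormedAddCommGroup E] [NormedSpace ℂ E]

/-- The `i`-th step of the staircase from `1` down to `0` that is built from the function
`r : X → ℝ`. -/
def rampFun (r : C(X, ℝ)) (i : ℕ) : C(X, ℂ) :=
  ⟨fun x => (ramp (r x + 1 - i) : ℂ), by have := continuous_ramp; fun_prop⟩

theorem rampFun_apply (r : C(X, ℝ)) (i : ℕ) (x : X) :
    rampFun r i x = (ramp (r x + 1 - i) : ℂ) := rfl

/-- The difference of two consecutive steps, a bump supported on `{i - 1 ≤ r ≤ i + 1}`. -/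
def hatFun (r : C(X, ℝ)) (i : ℕ) : C(X, ℂ) := rampFun r i - rampFun r (i + 1)

theorem hatFun_apply (r : C(X, ℝ)) (i : ℕ) (x : X) :
    hatFun r i x = ((ramp (r x + 1 - i) - ramp (r x + 1 - (i + 1 : ℕ)) : ℝ) : ℂ) := by
  simp [hatFun, rampFun_apply]

theorem rampFun_mul_one_sub (r : C(X, ℝ)) {i j : ℕ} (h : i + 1 ≤ j) :
    rampFun r j * (1 - rampFun r i) = 0 := by
  have h' : (i : ℝ) + 1 ≤ j := by exact_mod_cast h
  ext x
  simp only [ContinuousMap.mul_apply, ContinuousMap.sub_apply, ContinuousMap.one_apply,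
    rampFun_apply, ContinuousMap.zero_apply]
  rcases le_total (r x + 1 - j) 0 with h | h
  · simp [ramp_of_nonpos h]
  · simp [ramp_of_one_le (a := r x + 1 - i) (by linarith)]

theorem rampFun_mul_hatFun (r : C(X, ℝ)) {i j : ℕ} (h : i + 2 ≤ j) :
    rampFun r j * hatFun r i = 0 := by
  have h1 := rampFun_mul_one_sub r (i := i) (j := j) (by omega)
  have h2 := rampFun_mul_one_sub r (i := i + 1) (j := j) (by omega)
  calc rampFun r j * hatFun r i
      = rampFun r j * (1 - rampFun r (i + 1)) - rampFun r j * (1 - rampFun r i) := by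
        rw [hatFun]; ring
    _ = 0 := by rw [h1, h2, sub_zero]

theorem hatFun_mul_hatFun (r : C(X, ℝ)) {i j : ℕ} (h : i + 2 ≤ j) :
    hatFun r j * hatFun r i = 0 := by
  rw [hatFun, sub_mul, rampFun_mul_hatFun r h, rampFun_mul_hatFun r (by omega), sub_zero]

theorem norm_sum_hatFun_le [CompactSpace X] (r : C(X, ℝ)) (m c : ℕ) :
    ‖∑ k ∈ Finset.range m, hatFun r (3 * k + c)‖ ≤ 1 := by
  refine (ContinuousMap.norm_le _ zero_le_one).2 fun x => ?_
  have hnn : ∀ i : ℕ, 0 ≤ ramp (r x + 1 - i) - ramp (r x + 1 - (i + 1 : ℕ)) := fun i =>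
    sub_nonneg.2 (ramp_mono (by push_cast; linarith))
  set e : ℕ → ℝ := fun i => ramp (r x + 1 - i) - ramp (r x + 1 - (i + 1 : ℕ)) with he
  have h1 : (∑ k ∈ Finset.range m, hatFun r (3 * k + c)) x =
      ((∑ k ∈ Finset.range m, e (3 * k + c) : ℝ) : ℂ) := by
    rw [ContinuousMap.sum_apply, Complex.ofReal_sum]
    exact Finset.sum_congr rfl fun k _ => hatFun_apply r _ x
  rw [h1, Complex.norm_real, Real.norm_of_nonneg (Finset.sum_nonneg fun k _ => hnn _)]
  calc ∑ k ∈ Finset.range m, e (3 * k + c)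
      = ∑ i ∈ (Finset.range m).image (fun k => 3 * k + c), e i :=
        (Finset.sum_image fun a _ b _ h => by simpa using h).symm
    _ ≤ ∑ i ∈ Finset.range (3 * m + c), e i :=
        Finset.sum_le_sum_of_subset_of_nonneg (fun i hi => by
          obtain ⟨k, hk, rfl⟩ := Finset.mem_image.1 hi
          simp only [Finset.mem_range] at hk ⊢
          omega) fun i _ _ => hnn i
    _ = ramp (r x + 1 - (0 : ℕ)) - ramp (r x + 1 - (3 * m + c : ℕ)) :=
        Finset.sum_range_sub' (fun i : ℕ => ramp (r x + 1 - i)) _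
    _ ≤ 1 := by linarith [(ramp_mem (r x + 1 - (0 : ℕ))).2, (ramp_mem (r x + 1 - (3 * m + c : ℕ))).1]

variable (B : C(X, ℂ) →ₗ[ℂ] C(X, ℂ) →ₗ[ℂ] E) (hdisj : ∀ f h, f * h = 0 → B f h = 0)

include hdisj

/-- Only neighbouring bumps interact, so the commutator of a step with `1` is that of two bumps. -/
theorem bilin_rampFun_comm (r : C(X, ℝ)) (i : ℕ) :
    B (rampFun r (i + 1)) 1 - B 1 (rampFun r (i + 1)) =
      B (hatFun r (i + 1)) (hatFun r i) - B (hatFun r i) (hatFun r (i + 1)) := by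
  have e1 : (1 : C(X, ℂ)) = (1 - rampFun r i) + hatFun r i + rampFun r (i + 1) := by
    rw [hatFun]; ring
  have e2 : rampFun r (i + 1) = hatFun r (i + 1) + rampFun r (i + 2) := by
    rw [hatFun]; ring
  have a1 := rampFun_mul_one_sub r (i := i) (j := i + 1) le_rfl
  have a2 := rampFun_mul_hatFun r (i := i) (j := i + 2) le_rfl
  have z1 := hdisj _ _ a1
  have z2 := hdisj _ _ ((mul_comm _ _).trans a1)
  have z3 := hdisj _ _ a2
  have z4 := hdisj _ _ ((mul_comm _ _).trans a2)
  have l : B (rampFun r (i + 1)) 1 =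
      B (hatFun r (i + 1)) (hatFun r i) + B (rampFun r (i + 1)) (rampFun r (i + 1)) := by
    conv_lhs => rw [e1, map_add, map_add, z1, zero_add]
    conv_lhs => enter [1]; rw [e2, map_add, LinearMap.add_apply, z3, add_zero]
  have l' : B 1 (rampFun r (i + 1)) =
      B (hatFun r i) (hatFun r (i + 1)) + B (rampFun r (i + 1)) (rampFun r (i + 1)) := by
    conv_lhs => rw [e1, map_add, map_add, LinearMap.add_apply, LinearMap.add_apply, z2, zero_add]
    conv_lhs => enter [1]; rw [e2, map_add, z4, add_zero]
  rw [l, l']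
  abel

/-- Bumps with indices `3k + c + 1` and `3l + c` are disjoint unless `k = l`. -/
theorem sum_bilin_hatFun (r : C(X, ℝ)) (m c : ℕ) :
    ∑ k ∈ Finset.range m, (B (rampFun r (3 * k + c + 1)) 1 - B 1 (rampFun r (3 * k + c + 1))) =
      B (∑ k ∈ Finset.range m, hatFun r (3 * k + (c + 1)))
          (∑ k ∈ Finset.range m, hatFun r (3 * k + c)) -
        B (∑ k ∈ Finset.range m, hatFun r (3 * k + c))
          (∑ k ∈ Finset.range m, hatFun r (3 * k + (c + 1))) := by
  have off : ∀ k l, k ≠ l → hatFun r (3 * k + (c + 1)) * hatFun r (3 * l + c) = 0 :=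
    fun k l hkl => by
      rcases lt_or_gt_of_ne hkl with h | h
      · rw [mul_comm]; exact hatFun_mul_hatFun r (by omega)
      · exact hatFun_mul_hatFun r (by omega)
  simp only [map_sum, LinearMap.sum_apply]
  rw [← Finset.sum_sub_distrib]
  refine Finset.sum_congr rfl fun k hk => ?_
  rw [bilin_rampFun_comm B hdisj,
    Finset.sum_eq_single_of_mem k hk fun l _ hl => hdisj _ _ (off _ _ hl),
    Finset.sum_eq_single_of_mem k hk fun l _ hl =>
      hdisj _ _ ((mul_comm _ _).trans (off _ _ hl.symm)), add_assoc]

variable [CompactSpace X]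

theorem bilin_comm_one_of_mem_Icc {C : ℝ} (hC : ∀ f h, ‖B f h‖ ≤ C * ‖f‖ * ‖h‖) (r : C(X, ℝ))
    (hr : ∀ x, 0 ≤ r x ∧ r x ≤ 1) (f : C(X, ℂ)) (hf : ∀ x, f x = r x) : B f 1 = B 1 f := by
  set D : C(X, ℂ) →ₗ[ℂ] E := B.flip 1 - B 1 with hD
  have hDf : ∀ f, D f = B f 1 - B 1 f := fun f => rfl
  suffices D f = 0 from sub_eq_zero.1 this
  rcases le_or_gt C 0 with hC0 | hC0
  · have hz : ∀ f h, B f h = 0 := fun f h => norm_le_zero_iff.1 ((hC f h).trans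
      (mul_nonpos_of_nonpos_of_nonneg (mul_nonpos_of_nonpos_of_nonneg hC0 (norm_nonneg _))
        (norm_nonneg _)))
    rw [hDf, hz, hz, sub_zero]
  -- `(3m) f` is a sum of `3m` steps, and the commutators of the steps in one residue class modulo
  -- `3` add up to a single commutator of functions of norm at most `1`.
  have bound : ∀ m : ℕ, (3 * m : ℝ) * ‖D f‖ ≤ 6 * C := fun m => by
    set R : C(X, ℝ) := (3 * m : ℝ) • r with hR
    have hsum : ((3 * m : ℕ) : ℂ) • f = ∑ i ∈ Finset.range (3 * m), rampFun R (i + 1) := by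
      ext x
      have h := sum_ramp (3 * m) (a := R x)
        (by simp only [hR, ContinuousMap.smul_apply, smul_eq_mul]; have := (hr x).1; positivity)
        (by
          simp only [hR, ContinuousMap.smul_apply, smul_eq_mul]; push_cast
          exact mul_le_of_le_one_right (by positivity) (hr x).2)
      rw [ContinuousMap.sum_apply, ContinuousMap.smul_apply, hf, smul_eq_mul]
      have h' : (((3 * m : ℕ) : ℝ) * r x : ℝ) = R x := by
        simp [hR]
      calc ((3 * m : ℕ) : ℂ) * (r x : ℂ) = ((R x : ℝ) : ℂ) := by rw [← h']; push_cast; ring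
        _ = ((∑ i ∈ Finset.range (3 * m), ramp (R x - i) : ℝ) : ℂ) := by rw [h]
        _ = _ := by
          rw [Complex.ofReal_sum]
          refine Finset.sum_congr rfl fun i _ => ?_
          rw [rampFun_apply]
          congr 2
          push_cast; ring
    have hsplit : D (((3 * m : ℕ) : ℂ) • f) = ∑ c ∈ Finset.range 3,
        ∑ k ∈ Finset.range m, D (rampFun R (3 * k + c + 1)) := by
      rw [hsum, map_sum, Finset.sum_comm]
      clear hsum hR
      clear_value R
      induction m with
      | zero => simp
      | succ m ih =>
        rw [show 3 * (m + 1) = 3 * m + 1 + 1 + 1 by ring, Finset.sum_range_succ,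
          Finset.sum_range_succ, Finset.sum_range_succ, Finset.sum_range_succ, ih]
        simp only [Finset.sum_range_succ, Finset.sum_range_zero]
        simp only [add_zero, zero_add, add_assoc]
    have hle : ∀ c, ‖∑ k ∈ Finset.range m, D (rampFun R (3 * k + c + 1))‖ ≤ 2 * C := fun c => by
      simp only [hDf]
      rw [sum_bilin_hatFun B hdisj]
      have h1 := norm_sum_hatFun_le R m c
      have h2 := norm_sum_hatFun_le R m (c + 1)
      have hb : ∀ u v : C(X, ℂ), ‖u‖ ≤ 1 → ‖v‖ ≤ 1 → ‖B u v‖ ≤ C := fun u v hu hv =>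
        (hC u v).trans (by
          calc C * ‖u‖ * ‖v‖ ≤ C * 1 * 1 := by gcongr
            _ = C := by ring)
      calc _ ≤ _ := norm_sub_le _ _
        _ ≤ C + C := add_le_add (hb _ _ h2 h1) (hb _ _ h1 h2)
        _ = 2 * C := by ring
    have := norm_sum_le (Finset.range 3)
      (fun c => ∑ k ∈ Finset.range m, D (rampFun R (3 * k + c + 1)))
    rw [← hsplit, map_smul, norm_smul, Complex.norm_natCast] at this
    have h6 := Finset.sum_le_card_nsmul (Finset.range 3) _ _ fun c _ => hle c
    rw [Finset.card_range, nsmul_eq_mul] at h6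
    push_cast at this h6
    linarith
  by_contra hne
  have hpos : 0 < ‖D f‖ := norm_pos_iff.2 hne
  obtain ⟨m, hm⟩ := exists_nat_gt (6 * C / (3 * ‖D f‖))
  rw [div_lt_iff₀ (by positivity)] at hm
  have := bound m
  linarith

/-- A bounded bilinear map on `C(X)` that vanishes on pairs of functions with product `0`
satisfies `B f 1 = B 1 f`. -/
theorem bilin_comm_one {C : ℝ} (hC : ∀ f h, ‖B f h‖ ≤ C * ‖f‖ * ‖h‖) (f : C(X, ℂ)) :
    B f 1 = B 1 f := by
  set D : C(X, ℂ) →ₗ[ℂ] E := B.flip 1 - B 1 with hD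
  have hDf : ∀ f, D f = B f 1 - B 1 f := fun f => rfl
  have hD1 : D 1 = 0 := sub_self _
  have hreal : ∀ (r : C(X, ℝ)) (f : C(X, ℂ)), (∀ x, f x = r x) → D f = 0 := fun r f hf => by
    have hc : 0 < ‖r‖ + 1 := by positivity
    have hrx : ∀ x, |r x| ≤ ‖r‖ := fun x => r.norm_coe_le_norm x
    let r' : C(X, ℝ) := ⟨fun x => (r x / (‖r‖ + 1) + 1) / 2, by fun_prop⟩
    let f' : C(X, ℂ) := ⟨fun x => (r' x : ℂ), by fun_prop⟩
    have h' : B f' 1 = B 1 f' := bilin_comm_one_of_mem_Icc B hdisj hC r' (fun x => by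
      have h1 : -1 ≤ r x / (‖r‖ + 1) := by
        rw [le_div_iff₀ hc]; linarith [(abs_le.1 (hrx x)).1]
      have h2 : r x / (‖r‖ + 1) ≤ 1 := by
        rw [div_le_iff₀ hc]; linarith [(abs_le.1 (hrx x)).2]
      change 0 ≤ (r x / (‖r‖ + 1) + 1) / 2 ∧ (r x / (‖r‖ + 1) + 1) / 2 ≤ 1
      constructor <;> linarith) f' fun x => rfl
    have hf' : D f' = 0 := sub_eq_zero.2 h'
    have : f = (((‖r‖ + 1 : ℝ) : ℂ)) • ((2 : ℂ) • f' - 1) := by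
      ext x
      have hc' : ((‖r‖ : ℂ) + 1) ≠ 0 := by exact_mod_cast hc.ne'
      simp only [hf, ContinuousMap.smul_apply, ContinuousMap.sub_apply, ContinuousMap.one_apply,
        smul_eq_mul]
      change (r x : ℂ) = ((‖r‖ + 1 : ℝ) : ℂ) * (2 * (((r x / (‖r‖ + 1) + 1) / 2 : ℝ) : ℂ) - 1)
      push_cast
      field_simp
      ring
    rw [this, map_smul, map_sub, map_smul, hf', hD1, smul_zero, sub_zero, smul_zero]
  let re : C(X, ℝ) := ⟨fun x => (f x).re, by fun_prop⟩
  let im : C(X, ℝ) := ⟨fun x => (f x).im, by fun_prop⟩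
  let fre : C(X, ℂ) := ⟨fun x => (re x : ℂ), by fun_prop⟩
  let fim : C(X, ℂ) := ⟨fun x => (im x : ℂ), by fun_prop⟩
  have hf : f = fre + Complex.I • fim := by
    ext x
    change f x = ((f x).re : ℂ) + Complex.I * ((f x).im : ℂ)
    rw [mul_comm, Complex.re_add_im]
  refine sub_eq_zero.1 ?_
  rw [← hDf, hf, map_add, map_smul, hreal re fre fun _ => rfl, hreal im fim fun _ => rfl,
    smul_zero, add_zero]

/-- Applying the previous lemma to `(f, g) ↦ B (f k) g`. -/
theorem bilin_mul_one {C : ℝ} (hC : ∀ f h, ‖B f h‖ ≤ C * ‖f‖ * ‖h‖) (f h : C(X, ℂ)) :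
    B (f * h) 1 = B h f := by
  have h1 := bilin_comm_one (B.comp (LinearMap.mulRight ℂ h)) (fun u v huv => hdisj _ _ (by
    rw [LinearMap.mulRight_apply, mul_right_comm, huv, zero_mul])) (C := |C| * ‖h‖)
    (fun u v => by
      refine (hC _ _).trans ?_
      calc C * ‖u * h‖ * ‖v‖ ≤ |C| * (‖u‖ * ‖h‖) * ‖v‖ := by
            gcongr
            · exact le_abs_self C
            · exact norm_mul_le u h
        _ = |C| * ‖h‖ * ‖u‖ * ‖v‖ := by ring) f
  simpa using h1

end Disjoint

/-- An order zero map on `C(X)` satisfies `φ f φ h = φ (f h) φ 1`. -/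
theorem orderZero_mul {X : Type*} [TopologicalSpace X] [CompactSpace X] {F : Type*}
    [NonUnitalNormedRing F] [NormedSpace ℂ F] [IsScalarTower ℂ F F] [SMulCommClass ℂ F F]
    (φ : C(X, ℂ) →ₗ[ℂ] F) (hφ : ∀ f, ‖φ f‖ ≤ ‖f‖) (hz : ∀ f h, f * h = 0 → φ f * φ h = 0)
    (f h : C(X, ℂ)) : φ f * φ h = φ (f * h) * φ 1 := by
  have := bilin_mul_one (((LinearMap.mul ℂ F).compl₂ φ).comp φ) (fun u v huv => hz u v huv) (C := 1)
    (fun u v => by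
      rw [one_mul]
      exact (norm_mul_le _ _).trans (mul_le_mul (hφ u) (hφ v) (norm_nonneg _) (norm_nonneg _))) h f
  rw [mul_comm f h]
  exact this.symm

/-! ### Functions on a compact space built from order zero maps -/

/-- A functional on `C(X)` with `m f m h = m (f h) m 1` is a multiple of a point evaluation. -/
theorem exists_point_of_mul {X : Type*} [TopologicalSpace X] [CompactSpace X] [T2Space X]
    [Nonempty X] (m : C(X, ℂ) →ₗ[ℂ] ℂ) (hm : ∀ f h, m f * m h = m (f * h) * m 1) :
    ∃ x : X, ∀ f, m f = m 1 * f x := by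
  by_cases h1 : m 1 = 0
  · refine ⟨Classical.arbitrary X, fun f => ?_⟩
    have := hm f f
    rw [h1, mul_zero] at this
    rw [h1, zero_mul]
    exact mul_self_eq_zero.1 this
  · let χ : C(X, ℂ) →ₐ[ℂ] ℂ := AlgHom.ofLinearMap ((m 1)⁻¹ • m)
      (by simp [h1]) (fun f h => by
        have := hm f h
        simp only [LinearMap.smul_apply, smul_eq_mul]
        field_simp
        linear_combination -this)
    obtain ⟨x, hx⟩ := (WeakDual.CharacterSpace.continuousMapEval_bijective (X := X) (𝕜 := ℂ)).2
      (WeakDual.CharacterSpace.equivAlgHom.symm χ)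
    refine ⟨x, fun f => ?_⟩
    have h2 := congrArg (fun c : WeakDual.characterSpace ℂ C(X, ℂ) => c f) hx
    have h3 : f x = (m 1)⁻¹ * m f := h2
    rw [h3, mul_inv_cancel_left₀ h1]

section Points

variable {Y : Type*} [TopologicalSpace Y]
  {G : Type*} [TopologicalSpace G] [CompactSpace G] [T2Space G]
  {H : Type*} [TopologicalSpace H] [CompactSpace H] [T2Space H]

/-- The points `x y` depend continuously on `y` where the weight `t` does not vanish. -/
theorem continuousAt_point {t : Y → ℂ} {x : Y → G}
    (hx : ∀ f : C(G, ℂ), Continuous fun y => t y * f (x y)) {y₀ : Y} (h0 : t y₀ ≠ 0) :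
    ContinuousAt x y₀ := by
  rw [ContinuousAt, (nhds_basis_opens (x y₀)).tendsto_right_iff]
  rintro U ⟨hxU, hU⟩
  obtain ⟨f, hf0, hf1, -⟩ := exists_continuous_zero_one_of_isClosed hU.isClosed_compl
    (isClosed_singleton (x := x y₀)) (Set.disjoint_singleton_right.2 fun h => h hxU)
  let f' : C(G, ℂ) := ⟨fun z => (f z : ℂ), by fun_prop⟩
  have hne : t y₀ * f' (x y₀) ≠ 0 := by
    have : f' (x y₀) = 1 := by
      change ((f (x y₀) : ℝ) : ℂ) = 1
      rw [hf1 rfl]; simp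
    rwa [this, mul_one]
  filter_upwards [(hx f').continuousAt.eventually_ne hne] with y hy
  by_contra hyU
  refine hy ?_
  have : f' (x y) = 0 := by
    change ((f (x y) : ℝ) : ℂ) = 0
    rw [hf0 hyU]; simp
  rw [this, mul_zero]

/-- Where the points are not continuous in `y`, the weight `w` vanishes and `f` is bounded. -/
theorem continuous_weight_mul {t s w : Y → ℂ} {x : Y → G} {z : Y → H}
    (hx : ∀ f : C(G, ℂ), Continuous fun y => t y * f (x y))
    (hz : ∀ f : C(H, ℂ), Continuous fun y => s y * f (z y))
    (hw : Continuous w) (hwt : ∀ y, t y = 0 → w y = 0) (hws : ∀ y, s y = 0 → w y = 0)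
    (f : C(G × H, ℂ)) : Continuous fun y => w y * f (x y, z y) := by
  refine continuous_iff_continuousAt.2 fun y₀ => ?_
  by_cases h0 : w y₀ = 0
  · have h1 : Filter.Tendsto (fun y => ‖w y‖ * ‖f‖) (𝓝 y₀) (𝓝 0) := by
      have := (hw.norm.tendsto y₀).mul_const ‖f‖
      rwa [h0, norm_zero, zero_mul] at this
    rw [ContinuousAt, h0, zero_mul]
    refine squeeze_zero_norm (fun y => ?_) h1
    rw [norm_mul]
    exact mul_le_mul_of_nonneg_left (f.norm_coe_le_norm _) (norm_nonneg _)
  · have h1 := continuousAt_point hx fun h => h0 (hwt _ h)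
    have h2 := continuousAt_point hz fun h => h0 (hws _ h)
    exact hw.continuousAt.mul (f.continuous.continuousAt.comp (h1.prodMk h2))

end Points

/-- A linear map `φ` with `φ (f⋆ h) = (φ' f)⋆ φ' h` for some additive `φ'` is completely positive. -/
theorem IsCompletelyPositive.of_factor {R S : Type*} [NonUnitalRing R] [StarRing R] [Module ℂ R]
    [NonUnitalRing S] [StarRing S] [Module ℂ S] (φ : R →ₗ[ℂ] S) (φ' : R → S)
    (h : ∀ f g, φ (star f * g) = star (φ' f) * φ' g) : IsCompletelyPositive φ := by
  intro k M
  refine ⟨M.map φ', ?_⟩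
  ext a b
  simp [Matrix.mul_apply, h]

/-- A completely positive map on `C(X)` preserves adjoints. -/
theorem IsCompletelyPositive.map_star {X : Type*} [TopologicalSpace X]
    {S : Type*} [NonUnitalRing S] [StarRing S] [Module ℂ S] [StarModule ℂ S]
    {φ : C(X, ℂ) →ₗ[ℂ] S} (h : IsCompletelyPositive φ) (f : C(X, ℂ)) :
    φ (star f) = star (φ f) := by
  have hpos : ∀ g : C(X, ℂ), star (φ (star g * g)) = φ (star g * g) := fun g => by
    obtain ⟨N, hN⟩ := h 1 (Matrix.of fun _ _ => g)
    have := congrFun (congrFun hN 0) 0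
    simp only [Matrix.map_apply, Matrix.mul_apply, Matrix.conjTranspose_apply, Fin.sum_univ_one,
      Matrix.of_apply] at this
    rw [this, star_mul, star_star]
  -- Polarization: `4 f = |f + 1|² - |f - 1|² + i |f + i|² - i |f - i|²`.
  have pol : ∀ f : C(X, ℂ), (4 : ℂ) • f = (star (f + 1) * (f + 1) - star (f - 1) * (f - 1)) +
      Complex.I • (star (f + Complex.I • 1) * (f + Complex.I • 1) -
        star (f - Complex.I • 1) * (f - Complex.I • 1)) := fun f => by
    ext x
    simp only [ContinuousMap.smul_apply, ContinuousMap.add_apply, ContinuousMap.sub_apply,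
      ContinuousMap.mul_apply, ContinuousMap.star_apply, ContinuousMap.one_apply, smul_eq_mul,
      star_add, star_sub, star_mul', star_one, Complex.star_def, Complex.conj_I]
    linear_combination (2 * f x - 2 * (starRingEnd ℂ) (f x)) * Complex.I_sq
  have h4 : (4 : ℂ) • φ (star f) = (4 : ℂ) • star (φ f) := by
    have e1 := congrArg star (congrArg φ (pol f))
    have e2 := congrArg φ (congrArg star (pol f))
    have hs4 : star (4 : ℂ) = 4 := by simp
    simp only [map_add, map_sub, map_smul, star_add, star_sub, star_smul, star_mul, star_star,
      hs4] at e1 e2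
    rw [e1, e2]
    have hp := hpos (f + 1)
    have hp' := hpos (f - 1)
    have hp2 := hpos (f + Complex.I • 1)
    have hp2' := hpos (f - Complex.I • 1)
    simp only [star_add, star_sub, star_smul] at hp hp' hp2 hp2'
    rw [hp, hp', hp2, hp2']
  have := congrArg (fun z => (4⁻¹ : ℂ) • z) h4
  simpa [smul_smul] using this

theorem translate_apply {G : Type*} [Group G] [TopologicalSpace G] [IsTopologicalGroup G]
    (g x : G) (f : C(G, ℂ)) : translate g f x = f (g⁻¹ * x) := rfl

theorem IsCompletelyPositive.exists_map_one {X : Type*} [TopologicalSpace X]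
    {S : Type*} [NonUnitalRing S] [StarRing S] [Module ℂ S] {φ : C(X, ℂ) →ₗ[ℂ] S}
    (h : IsCompletelyPositive φ) : ∃ n, φ 1 = star n * n := by
  obtain ⟨N, hN⟩ := h 1 1
  have := congrFun (congrFun hN 0) 0
  simp only [Matrix.conjTranspose_one, mul_one, Matrix.map_apply, Matrix.one_apply_eq,
    Matrix.mul_apply, Matrix.conjTranspose_apply, Fin.sum_univ_one] at this
  exact ⟨_, this⟩

section Towers

variable {Y : Type*} [TopologicalSpace Y]
  {G : Type*} [TopologicalSpace G] {H : Type*} [TopologicalSpace H] {a b : ℕ}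

/-- The antidiagonal of `Fin (a + 1) × Fin (b + 1)` that contains `p`. -/
def level (p : Fin (a + 1) × Fin (b + 1)) : Fin (a + b + 1) := ⟨p.1 + p.2, by omega⟩

/-- Order zero maps `C(G) → C(Y)` and `C(H) → C(Y)` with sums of the images of `1` equal to `1`,
written through their weights `t_i`, `s_j` and points `x_i`, `z_j`: the `i`-th map sends `f` to the
function `y ↦ t_i(y) f(x_i(y))`. Continuity is required of these functions only; the point `x_i(y)`
is arbitrary where `t_i(y) = 0`. -/
structure PointTowers (Y G H : Type*) [TopologicalSpace Y] [TopologicalSpace G]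
    [TopologicalSpace H] (a b : ℕ) where
  t : Fin (a + 1) → Y → ℝ
  s : Fin (b + 1) → Y → ℝ
  x : Fin (a + 1) → Y → G
  z : Fin (b + 1) → Y → H
  t_nonneg : ∀ i y, 0 ≤ t i y
  s_nonneg : ∀ j y, 0 ≤ s j y
  sum_t : ∀ y, ∑ i, t i y = 1
  sum_s : ∀ y, ∑ j, s j y = 1
  continuous_x : ∀ i (f : C(G, ℂ)), Continuous fun y => (t i y : ℂ) * f (x i y)
  continuous_z : ∀ j (f : C(H, ℂ)), Continuous fun y => (s j y : ℂ) * f (z j y)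

namespace PointTowers

variable (P : PointTowers Y G H a b)

theorem continuous_t (i : Fin (a + 1)) : Continuous (P.t i) := by
  have := Complex.continuous_re.comp (P.continuous_x i 1)
  simpa [Function.comp_def] using this

theorem continuous_s (j : Fin (b + 1)) : Continuous (P.s j) := by
  have := Complex.continuous_re.comp (P.continuous_z j 1)
  simpa [Function.comp_def] using this

/-- The staircase weights at `y`. -/
def weight (p : Fin (a + 1) × Fin (b + 1)) (y : Y) : ℝ :=
  overlap (fun i => P.t i y) (fun j => P.s j y) p.1 p.2

theorem weight_nonneg (p : Fin (a + 1) × Fin (b + 1)) (y : Y) : 0 ≤ P.weight p y :=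
  overlap_nonneg (fun j => P.s_nonneg j y) _ _

theorem sum_weight (y : Y) : ∑ p, P.weight p y = 1 :=
  sum_overlap (fun i => P.t_nonneg i y) (P.sum_t y) (P.sum_s y)

theorem continuous_weight (p : Fin (a + 1) × Fin (b + 1)) : Continuous (P.weight p) := by
  have ht := P.continuous_t
  have hs := P.continuous_s
  have h1 : ∀ i, Continuous fun y => cumSum (fun l => P.t l y) i := fun i =>
    continuous_finsetSum _ fun l _ => ht l
  have h2 : ∀ i, Continuous fun y => cumSum (fun l => P.s l y) i := fun i =>
    continuous_finsetSum _ fun l _ => hs l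
  unfold weight overlap
  fun_prop

theorem weight_mul_weight {p q : Fin (a + 1) × Fin (b + 1)} (hpq : p ≠ q)
    (hl : level p = level q) (y : Y) : P.weight p y * P.weight q y = 0 :=
  overlap_mul_overlap (fun i => P.t_nonneg i y) (fun j => P.s_nonneg j y) hpq
    (congrArg Fin.val hl)

variable [CompactSpace G] [T2Space G] [CompactSpace H] [T2Space H]

/-- The map `f ↦ ∑ λ_p f (x_i, z_j)`, the sum being over one antidiagonal of indices `p = (i, j)`,
and `λ_p` a continuous function of the staircase weight that vanishes at `0`. -/
def antidiagMap (u : ℝ → ℝ) (hu : Continuous u) (hu0 : u 0 = 0) (k : Fin (a + b + 1)) :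
    C(G × H, ℂ) →ₗ[ℂ] C(Y, ℂ) where
  toFun f := ⟨fun y => ∑ p with level p = k, (u (P.weight p y) : ℂ) * f (P.x p.1 y, P.z p.2 y), by
    refine continuous_finsetSum _ fun p _ => ?_
    refine continuous_weight_mul (P.continuous_x p.1) (P.continuous_z p.2)
      (Complex.continuous_ofReal.comp (hu.comp (P.continuous_weight p))) (fun y h => ?_)
      (fun y h => ?_) f
    · have : P.weight p y = 0 := overlap_eq_zero_left (Complex.ofReal_eq_zero.1 h) _
      simp [this, hu0]
    · have : P.weight p y = 0 := overlap_eq_zero_right _ (Complex.ofReal_eq_zero.1 h)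
      simp [this, hu0]⟩
  map_add' f h := by
    ext y
    simp [mul_add, Finset.sum_add_distrib]
  map_smul' c f := by
    ext y
    simp only [ContinuousMap.coe_mk, ContinuousMap.smul_apply, smul_eq_mul, RingHom.id_apply,
      Finset.mul_sum]
    exact Finset.sum_congr rfl fun p _ => by ring

theorem antidiagMap_apply (u : ℝ → ℝ) (hu : Continuous u) (hu0 : u 0 = 0) (k : Fin (a + b + 1))
    (f : C(G × H, ℂ)) (y : Y) : P.antidiagMap u hu hu0 k f y =
      ∑ p with level p = k, (u (P.weight p y) : ℂ) * f (P.x p.1 y, P.z p.2 y) := rfl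

theorem antidiagMap_mul {u v w : ℝ → ℝ} (hu : Continuous u) (hu0 : u 0 = 0) (hv : Continuous v)
    (hv0 : v 0 = 0) (hw : Continuous w) (hw0 : w 0 = 0) (huv : ∀ c, 0 ≤ c → u c * v c = w c)
    (k : Fin (a + b + 1)) (f h : C(G × H, ℂ)) :
    P.antidiagMap u hu hu0 k f * P.antidiagMap v hv hv0 k h = P.antidiagMap w hw hw0 k (f * h) := by
  ext y
  simp only [ContinuousMap.mul_apply, antidiagMap_apply]
  rw [Finset.sum_mul]
  refine Finset.sum_congr rfl fun p hp => ?_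
  rw [Finset.mul_sum, Finset.sum_eq_single_of_mem p hp fun q hq hqp => ?_]
  · rw [← huv _ (P.weight_nonneg p y)]
    push_cast
    ring
  · have hl : level p = level q := by
      simp only [Finset.mem_filter, Finset.mem_univ, true_and] at hp hq
      rw [hp, hq]
    rcases mul_eq_zero.1 (P.weight_mul_weight hqp.symm hl y) with h0 | h0 <;> simp [h0, hu0, hv0]

/-- The `k`-th tower of the product, a map `C(G × H) → C(Y)`. -/
def tower (k : Fin (a + b + 1)) : C(G × H, ℂ) →ₗ[ℂ] C(Y, ℂ) :=
  P.antidiagMap id continuous_id rfl k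

theorem tower_mul_tower {f h : C(G × H, ℂ)} (hfh : f * h = 0) (k : Fin (a + b + 1)) :
    P.tower k f * P.tower k h = 0 := by
  rw [tower, P.antidiagMap_mul (u := id) (v := id) (w := fun c => c * c) continuous_id rfl
    continuous_id rfl (by fun_prop) (by simp) (fun _ _ => rfl), hfh, map_zero]

theorem tower_star_mul (k : Fin (a + b + 1)) (f h : C(G × H, ℂ)) :
    P.tower k (star f * h) = star (P.antidiagMap Real.sqrt Real.continuous_sqrt Real.sqrt_zero k f) *
      P.antidiagMap Real.sqrt Real.continuous_sqrt Real.sqrt_zero k h := by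
  have hstar : star (P.antidiagMap Real.sqrt Real.continuous_sqrt Real.sqrt_zero k f) =
      P.antidiagMap Real.sqrt Real.continuous_sqrt Real.sqrt_zero k (star f) := by
    ext y
    simp [antidiagMap_apply]
  rw [hstar, P.antidiagMap_mul (u := Real.sqrt) (v := Real.sqrt) (w := id) _ _ _ _ continuous_id
    rfl (fun c hc => Real.mul_self_sqrt hc)]
  rfl

theorem norm_tower_apply_le (k : Fin (a + b + 1)) (f : C(G × H, ℂ)) (y : Y) :
    ‖P.tower k f y‖ ≤ ‖f‖ := by
  calc ‖P.tower k f y‖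
      ≤ ∑ p with level p = k, ‖(P.weight p y : ℂ) * f (P.x p.1 y, P.z p.2 y)‖ := norm_sum_le _ _
    _ ≤ ∑ p with level p = k, P.weight p y * ‖f‖ := Finset.sum_le_sum fun p _ => by
        rw [norm_mul, Complex.norm_real, Real.norm_of_nonneg (P.weight_nonneg p y)]
        exact mul_le_mul_of_nonneg_left (f.norm_coe_le_norm _) (P.weight_nonneg p y)
    _ ≤ ∑ p, P.weight p y * ‖f‖ := Finset.sum_le_sum_of_subset_of_nonneg (Finset.subset_univ _)
        fun p _ _ => mul_nonneg (P.weight_nonneg p y) (norm_nonneg _)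
    _ = ‖f‖ := by rw [← Finset.sum_mul, P.sum_weight, one_mul]

theorem sum_tower_one : ∑ k, P.tower k 1 = 1 := by
  ext y
  rw [ContinuousMap.sum_apply]
  have h : ∀ k, P.tower k 1 y = ∑ p with level p = k, (P.weight p y : ℂ) := fun k => by
    simp [tower, antidiagMap_apply]
  simp only [h]
  rw [Finset.sum_fiberwise, ← Complex.ofReal_sum, P.sum_weight]
  simp

theorem point_eq_of_weight {X : Type*} [TopologicalSpace X] [CompactSpace X] [T2Space X]
    {t t' : ℝ} {x x' : X} (h : ∀ f : C(X, ℂ), (t : ℂ) * f x = t' * f x') (ht : t ≠ 0) :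
    t = t' ∧ x = x' := by
  have h1 : t = t' := by simpa using h 1
  subst h1
  refine ⟨rfl, ?_⟩
  by_contra hne
  obtain ⟨f, hf0, hf1, -⟩ := exists_continuous_zero_one_of_isClosed
    (isClosed_singleton (x := x)) (isClosed_singleton (x := x'))
    (Set.disjoint_singleton.2 hne)
  have := mul_left_cancel₀ (Complex.ofReal_ne_zero.2 ht) (h ⟨fun z => (f z : ℂ), by fun_prop⟩)
  simp [hf0 (Set.mem_singleton x), hf1 (Set.mem_singleton x')] at this

theorem tower_equivariant [Group G] [IsTopologicalGroup G] [Group H] [IsTopologicalGroup H]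
    (κ : Y → Y) (g : G) (h : H)
    (hx : ∀ i (f : C(G, ℂ)) y, (P.t i (κ y) : ℂ) * f (P.x i (κ y)) =
      P.t i y * translate g f (P.x i y))
    (hz : ∀ j (f : C(H, ℂ)) y, (P.s j (κ y) : ℂ) * f (P.z j (κ y)) =
      P.s j y * translate h f (P.z j y))
    (k : Fin (a + b + 1)) (f : C(G × H, ℂ)) (y : Y) :
    P.tower k f (κ y) = P.tower k (translate (g, h) f) y := by
  have ht : ∀ i, P.t i (κ y) = P.t i y := fun i => by
    have := hx i 1 y
    simpa [translate_apply] using this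
  have hs : ∀ j, P.s j (κ y) = P.s j y := fun j => by
    have := hz j 1 y
    simpa [translate_apply] using this
  simp only [tower, antidiagMap_apply, id]
  refine Finset.sum_congr rfl fun p _ => ?_
  have hw : P.weight p (κ y) = P.weight p y := by simp only [weight, ht, hs]
  rw [hw]
  by_cases h0 : P.weight p y = 0
  · simp [h0]
  have h1 : P.t p.1 y ≠ 0 := fun hc => h0 (overlap_eq_zero_left hc _)
  have h2 : P.s p.2 y ≠ 0 := fun hc => h0 (overlap_eq_zero_right _ hc)
  have e1 := (point_eq_of_weight (fun f => hx p.1 f y) (by rwa [ht])).2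
  have e2 := (point_eq_of_weight (fun f => hz p.2 f y) (by rwa [hs])).2
  rw [e1, e2]
  rfl

end PointTowers

end Towers

/-! ### Quotients of C⋆-algebras -/

namespace ClosedStarIdeal

variable {A : Type*} [NonUnitalCStarAlgebra A]

/-- A closed ideal, as a nonunital star subalgebra. -/
def toSubalgebra (I : ClosedStarIdeal A) : NonUnitalStarSubalgebra ℂ A where
  carrier := I.carrier
  add_mem' := I.add_mem'
  zero_mem' := I.zero_mem'
  smul_mem' := I.smul_mem'
  mul_mem' {x _} _ hy := I.mul_left_mem x _ hy
  star_mem' {_} hx := I.star_mem _ hx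

/-- An element of a closed ideal has approximate right units of norm at most `1`, here in the form
needed for the C⋆-identity of the quotient. -/
theorem exists_approx (I : ClosedStarIdeal A) {c : A} (hc : c ∈ I.toSubmodule) {ε : ℝ}
    (hε : 0 < ε) : ∃ e ∈ I.toSubmodule, star e = e ∧ ‖c - c * e‖ < ε ∧
      ‖(1 - e : Unitization ℂ A)‖ ≤ 1 := by
  let J := I.toSubalgebra
  have hJ : IsClosed (J : Set A) := I.isClosed
  let _ : NonUnitalCStarAlgebra J := NonUnitalStarSubalgebra.nonUnitalCStarAlgebra J (h_closed := hJ)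
  let _ : PartialOrder J := CStarAlgebra.spectralOrder J
  have _ : StarOrderedRing J := CStarAlgebra.spectralOrderedRing J
  let _ : PartialOrder A := CStarAlgebra.spectralOrder A
  have _ : StarOrderedRing A := CStarAlgebra.spectralOrderedRing A
  have hl := CStarAlgebra.increasingApproximateUnit J
  have h1 := hl.tendsto_mul_left ⟨c, hc⟩
  have h2 : ∀ᶠ x in CStarAlgebra.approximateUnit J, ‖(⟨c, hc⟩ : J) - ⟨c, hc⟩ * x‖ < ε := by
    have := (tendsto_const_nhds (x := (⟨c, hc⟩ : J))).sub h1
    rw [sub_self] at this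
    have h3 := this.norm
    rw [norm_zero] at h3
    exact h3.eventually_lt_const hε
  obtain ⟨e, ⟨⟨he0, he1⟩, hes⟩, hee⟩ := (((hl.eventually_nonneg.and hl.eventually_norm).and
    hl.eventually_star_eq).and h2).exists
  refine ⟨e, e.2, congrArg Subtype.val hes, hee, ?_⟩
  have hpos : 0 ≤ (e : A) := by
    obtain ⟨s, hs⟩ := CStarAlgebra.nonneg_iff_eq_star_mul_self.1 he0
    rw [hs]
    exact star_mul_self_nonneg (s : A)
  have h0 : (0 : Unitization ℂ A) ≤ ((e : A) : Unitization ℂ A) := Unitization.inr_nonneg_iff.2 hpos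
  have h1' : ((e : A) : Unitization ℂ A) ≤ 1 := by
    rw [← CStarAlgebra.norm_le_one_iff_of_nonneg _ h0, Unitization.norm_inr]
    exact he1
  rw [CStarAlgebra.norm_le_one_iff_of_nonneg _ (sub_nonneg.2 h1')]
  exact sub_le_self _ h0

theorem norm_mul_self_le (I : ClosedStarIdeal A) (x : I.QuotAlg) : ‖x‖ * ‖x‖ ≤ ‖star x * x‖ := by
  obtain ⟨x, rfl⟩ := QuotAlg.mkL_surjective x
  refine le_of_forall_pos_le_add fun ε hε => ?_
  obtain ⟨y, hy, hyn⟩ := QuotAlg.exists_norm_lt (star (QuotAlg.mkL I x) * QuotAlg.mkL I x)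
    (half_pos hε)
  rw [← QuotAlg.mkL_star, ← QuotAlg.mkL_mul, QuotAlg.mkL_eq_iff] at hy
  -- `x⋆ x = y - c` with `c` in the ideal, and cutting down by `1 - e` makes `c` small.
  set c := y - star x * x with hc
  obtain ⟨e, heI, hes, hce, he1⟩ := I.exists_approx hy (half_pos hε)
  have hmk : QuotAlg.mkL I x = QuotAlg.mkL I (x - x * e) := by
    rw [QuotAlg.mkL_eq_iff, sub_sub_cancel]
    exact I.mul_left_mem _ _ heI
  have hval : ((star (x - x * e) * (x - x * e) : A) : Unitization ℂ A) =
      (1 - (e : Unitization ℂ A)) * (y : Unitization ℂ A) * (1 - (e : Unitization ℂ A)) -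
        (1 - (e : Unitization ℂ A)) * ((c - c * e : A) : Unitization ℂ A) := by
    have : y = c + star x * x := by rw [hc]; abel
    rw [this, star_sub, star_mul, hes]
    simp only [Unitization.inr_mul, Unitization.inr_sub, Unitization.inr_add]
    noncomm_ring
  calc ‖QuotAlg.mkL I x‖ * ‖QuotAlg.mkL I x‖ ≤ ‖x - x * e‖ * ‖x - x * e‖ := by
        rw [hmk]
        exact mul_self_le_mul_self (norm_nonneg _) (QuotAlg.norm_mkL_le _)
    _ = ‖((star (x - x * e) * (x - x * e) : A) : Unitization ℂ A)‖ := by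
        rw [Unitization.norm_inr, CStarRing.norm_star_mul_self]
    _ ≤ 1 * ‖y‖ * 1 + 1 * ‖c - c * e‖ := by
        rw [hval]
        refine (norm_sub_le _ _).trans (add_le_add ?_ ?_)
        · refine (norm_mul_le _ _).trans (mul_le_mul ((norm_mul_le _ _).trans ?_) he1
            (norm_nonneg _) (by positivity))
          rw [Unitization.norm_inr]
          exact mul_le_mul_of_nonneg_right he1 (norm_nonneg _)
        · refine (norm_mul_le _ _).trans ?_
          rw [Unitization.norm_inr]
          exact mul_le_mul_of_nonneg_right he1 (norm_nonneg _)
    _ ≤ ‖star (QuotAlg.mkL I x) * QuotAlg.mkL I x‖ + ε := by linarith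

instance (I : ClosedStarIdeal A) : NonUnitalCStarAlgebra I.QuotAlg where
  norm_mul_self_le := I.norm_mul_self_le

end ClosedStarIdeal

section Sequence

variable (A : Type*) [NonUnitalCStarAlgebra A]

instance : IsClosed (CentralSeq A : Set (SeqAlg A)) := by
  have : (CentralSeq A : Set (SeqAlg A)) = ⋂ a : A, {x | diag A a * x = x * diag A a} := by
    ext x
    simp only [SetLike.mem_coe, Set.mem_iInter, Set.mem_ofPred_eq]
    exact CentralSeq.mem_iff
  rw [this]
  exact isClosed_iInter fun a => isClosed_eq (by fun_prop) (by fun_prop)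

instance : NonUnitalCStarAlgebra (CentralSeq A) :=
  NonUnitalStarSubalgebra.nonUnitalCStarAlgebra (CentralSeq A)

instance : NonUnitalCStarAlgebra (FInf A) :=
  inferInstanceAs (NonUnitalCStarAlgebra (annihilator A).QuotAlg)

end Sequence

/-- A nonunital C⋆-algebra with an element `u` that acts as a unit, as a C⋆-algebra with unit `u`. -/
abbrev cstarAlgebraOfUnit (F : Type*) [i : NonUnitalCStarAlgebra F] (u : F)
    (hu : ∀ x, u * x = x ∧ x * u = x) : CStarAlgebra F :=
  letI r : NormedRing F :=
    { i with
      one := u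
      one_mul := fun x => (hu x).1
      mul_one := fun x => (hu x).2 }
  letI a : NormedAlgebra ℂ F :=
    { Algebra.ofModule smul_mul_assoc mul_smul_comm with
      norm_smul_le := norm_smul_le }
  { i, r, a with }

/-! ### Products of towers in a unital C⋆-algebra -/

open scoped ComplexOrder in
/-- Order zero maps into `C(Y)` in terms of weights and points. -/
theorem exists_pointTowers {Y : Type*} [TopologicalSpace Y]
    {G : Type*} [TopologicalSpace G] [CompactSpace G] [T2Space G] [Nonempty G]
    {H : Type*} [TopologicalSpace H] [CompactSpace H] [T2Space H] [Nonempty H] {a b : ℕ}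
    (φ : Fin (a + 1) → C(G, ℂ) →ₗ[ℂ] C(Y, ℂ)) (ψ : Fin (b + 1) → C(H, ℂ) →ₗ[ℂ] C(Y, ℂ))
    (hφm : ∀ i f h, φ i f * φ i h = φ i (f * h) * φ i 1)
    (hψm : ∀ j f h, ψ j f * ψ j h = ψ j (f * h) * ψ j 1)
    (hφ0 : ∀ i y, 0 ≤ φ i 1 y) (hψ0 : ∀ j y, 0 ≤ ψ j 1 y)
    (hφ1 : ∑ i, φ i 1 = 1) (hψ1 : ∑ j, ψ j 1 = 1) :
    ∃ P : PointTowers Y G H a b, (∀ i f y, φ i f y = P.t i y * f (P.x i y)) ∧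
      ∀ j f y, ψ j f y = P.s j y * f (P.z j y) := by
  have hφx : ∀ i y, ∃ x : G, ∀ f, φ i f y = φ i 1 y * f x := fun i y =>
    exists_point_of_mul ((ContinuousMap.evalCLM ℂ y : C(Y, ℂ) →L[ℂ] ℂ).toLinearMap.comp (φ i))
      fun f h => congrArg (fun u : C(Y, ℂ) => u y) (hφm i f h)
  have hψx : ∀ j y, ∃ z : H, ∀ f, ψ j f y = ψ j 1 y * f z := fun j y =>
    exists_point_of_mul ((ContinuousMap.evalCLM ℂ y : C(Y, ℂ) →L[ℂ] ℂ).toLinearMap.comp (ψ j))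
      fun f h => congrArg (fun u : C(Y, ℂ) => u y) (hψm j f h)
  choose x hx using hφx
  choose z hz using hψx
  have hre : ∀ i y, ((φ i 1 y).re : ℂ) = φ i 1 y := fun i y =>
    (Complex.eq_re_of_ofReal_le (r := 0) (by simpa using hφ0 i y)).symm
  have hre' : ∀ j y, ((ψ j 1 y).re : ℂ) = ψ j 1 y := fun j y =>
    (Complex.eq_re_of_ofReal_le (r := 0) (by simpa using hψ0 j y)).symm
  refine ⟨{
    t := fun i y => (φ i 1 y).re
    s := fun j y => (ψ j 1 y).re
    x := x
    z := z
    t_nonneg := fun i y => (Complex.nonneg_iff.1 (hφ0 i y)).1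
    s_nonneg := fun j y => (Complex.nonneg_iff.1 (hψ0 j y)).1
    sum_t := fun y => by
      have := congrArg (fun u : C(Y, ℂ) => (u y).re) hφ1
      simpa [ContinuousMap.sum_apply] using this
    sum_s := fun y => by
      have := congrArg (fun u : C(Y, ℂ) => (u y).re) hψ1
      simpa [ContinuousMap.sum_apply] using this
    continuous_x := fun i f => by simpa only [hre, ← hx] using (φ i f).continuous
    continuous_z := fun j f => by simpa only [hre', ← hz] using (ψ j f).continuous },
    fun i f y => ?_, fun j f y => ?_⟩
  · rw [hre]; exact hx i y f
  · rw [hre']; exact hz j y f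

section Abstract

variable {F : Type*} [CStarAlgebra F]
  {G : Type*} [Group G] [TopologicalSpace G] [IsTopologicalGroup G] [CompactSpace G] [T2Space G]
  {H : Type*} [Group H] [TopologicalSpace H] [IsTopologicalGroup H] [CompactSpace H] [T2Space H]
  {a b : ℕ}

open scoped ComplexOrder in
theorem character_nonneg {D : StarSubalgebra ℂ F} (hD : IsClosed (D : Set F)) (n : F)
    (hn : star n * n ∈ D) (χ : WeakDual.characterSpace ℂ D) : 0 ≤ χ ⟨star n * n, hn⟩ := by
  let _ : PartialOrder F := CStarAlgebra.spectralOrder F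
  have _ : StarOrderedRing F := CStarAlgebra.spectralOrderedRing F
  have h1 : χ ⟨star n * n, hn⟩ ∈ spectrum ℂ (⟨star n * n, hn⟩ : D) :=
    AlgHom.apply_mem_spectrum χ _
  rw [StarSubalgebra.spectrum_eq (hS := hD)] at h1
  have hsa : IsSelfAdjoint (star n * n) := IsSelfAdjoint.star_mul_self n
  have h2 := hsa.mem_spectrum_eq_re h1
  rw [h2] at h1 ⊢
  have h3 : (χ ⟨star n * n, hn⟩).re ∈ spectrum ℝ (star n * n) := by
    rw [← spectrum.algebraMap_mem_iff ℂ]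
    exact h1
  have := spectrum_nonneg_of_nonneg (star_mul_self_nonneg n) h3
  exact_mod_cast this

/-- Two systems of order zero towers with commuting ranges, over `G` and `H`, combine to towers over
`G × H`. Their number is one less than the sum of the numbers of towers. -/
theorem exists_product_towers
    (φ : Fin (a + 1) → C(G, ℂ) →ₗ[ℂ] F) (ψ : Fin (b + 1) → C(H, ℂ) →ₗ[ℂ] F)
    (hφs : ∀ i f, φ i (star f) = star (φ i f)) (hψs : ∀ j f, ψ j (star f) = star (ψ j f))
    (hφm : ∀ i f h, φ i f * φ i h = φ i (f * h) * φ i 1)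
    (hψm : ∀ j f h, ψ j f * ψ j h = ψ j (f * h) * ψ j 1)
    (hφ0 : ∀ i, ∃ n, φ i 1 = star n * n) (hψ0 : ∀ j, ∃ n, ψ j 1 = star n * n)
    (hφ1 : ∑ i, φ i 1 = 1) (hψ1 : ∑ j, ψ j 1 = 1)
    (hφφ : ∀ i j f h, φ i f * φ j h = φ j h * φ i f)
    (hψψ : ∀ i j f h, ψ i f * ψ j h = ψ j h * ψ i f)
    (hφψ : ∀ i j f h, φ i f * ψ j h = ψ j h * φ i f) :
    ∃ θ : Fin (a + b + 1) → C(G × H, ℂ) →ₗ[ℂ] F,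
      (∀ k, IsCompletelyPositive (θ k)) ∧
      (∀ k f, ‖θ k f‖ ≤ ‖f‖) ∧
      (∀ k f h, f * h = 0 → θ k f * θ k h = 0) ∧
      (∀ (σ : F →⋆ₐ[ℂ] F) (g : G) (h : H), (∀ i f, φ i (translate g f) = σ (φ i f)) →
        (∀ j f, ψ j (translate h f) = σ (ψ j f)) →
        ∀ k f, θ k (translate (g, h) f) = σ (θ k f)) ∧
      (∀ k l f h, θ k f * θ l h = θ l h * θ k f) ∧
      ∑ k, θ k 1 = 1 := by
  let S : Set F := {x | (∃ i f, φ i f = x) ∨ ∃ j f, ψ j f = x}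
  have hScomm : ∀ x ∈ S, ∀ y ∈ S, x * y = y * x := by
    rintro _ (⟨i, f, rfl⟩ | ⟨i, f, rfl⟩) _ (⟨j, h, rfl⟩ | ⟨j, h, rfl⟩)
    · exact hφφ i j f h
    · exact hφψ i j f h
    · exact (hφψ j i h f).symm
    · exact hψψ i j f h
  have hSstar : ∀ x ∈ S, star x ∈ S := by
    rintro _ (⟨i, f, rfl⟩ | ⟨i, f, rfl⟩)
    · exact Or.inl ⟨i, star f, hφs i f⟩
    · exact Or.inr ⟨i, star f, hψs i f⟩
  let D₀ : StarSubalgebra ℂ F := StarAlgebra.adjoin ℂ S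
  let D : StarSubalgebra ℂ F := D₀.topologicalClosure
  have hD : IsClosed (D : Set F) := D₀.isClosed_topologicalClosure
  have hD₀ : ∀ x y : D₀, x * y = y * x :=
    (StarAlgebra.isMulCommutative_adjoin ℂ hScomm
      fun x hx y hy => hScomm x hx _ (hSstar y hy)).is_comm.comm
  have hDcomm : ∀ x y : D, x * y = y * x := (D₀.commRingTopologicalClosure hD₀).mul_comm
  let cD : CStarAlgebra D := StarSubalgebra.cstarAlgebra D (h_closed := hD)
  let _ : CommCStarAlgebra D := { cD with mul_comm := hDcomm }
  let Γ := gelfandStarTransform D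
  have hSD : S ⊆ D := fun x hx => D₀.le_topologicalClosure (StarAlgebra.subset_adjoin ℂ S hx)
  have hφD : ∀ i f, φ i f ∈ D := fun i f => hSD (Or.inl ⟨i, f, rfl⟩)
  have hψD : ∀ j f, ψ j f ∈ D := fun j f => hSD (Or.inr ⟨j, f, rfl⟩)
  let φ' : Fin (a + 1) → C(G, ℂ) →ₗ[ℂ] C(WeakDual.characterSpace ℂ D, ℂ) := fun i =>
    { toFun := fun f => Γ ⟨φ i f, hφD i f⟩
      map_add' := fun f h => by
        rw [← map_add]; exact congrArg Γ (Subtype.ext (map_add (φ i) f h))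
      map_smul' := fun c f => by
        rw [RingHom.id_apply, ← map_smul]; exact congrArg Γ (Subtype.ext (map_smul (φ i) c f)) }
  let ψ' : Fin (b + 1) → C(H, ℂ) →ₗ[ℂ] C(WeakDual.characterSpace ℂ D, ℂ) := fun j =>
    { toFun := fun f => Γ ⟨ψ j f, hψD j f⟩
      map_add' := fun f h => by
        rw [← map_add]; exact congrArg Γ (Subtype.ext (map_add (ψ j) f h))
      map_smul' := fun c f => by
        rw [RingHom.id_apply, ← map_smul]; exact congrArg Γ (Subtype.ext (map_smul (ψ j) c f)) }
  have hφ' : ∀ i f, φ' i f = Γ ⟨φ i f, hφD i f⟩ := fun _ _ => rfl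
  have hψ' : ∀ j f, ψ' j f = Γ ⟨ψ j f, hψD j f⟩ := fun _ _ => rfl
  obtain ⟨P, hPx, hPz⟩ := exists_pointTowers φ' ψ'
    (fun i f h => by
      simp only [hφ', ← map_mul]; exact congrArg Γ (Subtype.ext (hφm i f h)))
    (fun j f h => by
      simp only [hψ', ← map_mul]; exact congrArg Γ (Subtype.ext (hψm j f h)))
    (fun i χ => by
      obtain ⟨n, hn⟩ := hφ0 i
      have h := character_nonneg hD n (hn ▸ hφD i 1) χ
      rw [hφ']
      simp only [hn]
      exact h)
    (fun j χ => by
      obtain ⟨n, hn⟩ := hψ0 j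
      have h := character_nonneg hD n (hn ▸ hψD j 1) χ
      rw [hψ']
      simp only [hn]
      exact h)
    (by
      simp only [hφ', ← map_sum]
      rw [← map_one Γ]
      exact congrArg Γ (Subtype.ext (by rw [AddSubmonoidClass.coe_finsetSum]; exact hφ1)))
    (by
      simp only [hψ', ← map_sum]
      rw [← map_one Γ]
      exact congrArg Γ (Subtype.ext (by rw [AddSubmonoidClass.coe_finsetSum]; exact hψ1)))
  let ι : C(WeakDual.characterSpace ℂ D, ℂ) →⋆ₐ[ℂ] F := D.subtype.comp Γ.symm
  let θ : Fin (a + b + 1) → C(G × H, ℂ) →ₗ[ℂ] F := fun k =>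
    (ι : C(WeakDual.characterSpace ℂ D, ℂ) →ₗ[ℂ] F).comp (P.tower k)
  have hθ : ∀ k f, θ k f = ι (P.tower k f) := fun _ _ => rfl
  refine ⟨θ, fun k => ?_, fun k f => ?_, fun k f h hfh => ?_, fun σ g h hσφ hσψ k f => ?_,
    fun k l f h => ?_, ?_⟩
  · refine IsCompletelyPositive.of_factor _
      (fun f => ι (P.antidiagMap Real.sqrt Real.continuous_sqrt Real.sqrt_zero k f)) fun f h => ?_
    rw [hθ, P.tower_star_mul, map_mul, map_star]
  · exact (NonUnitalStarAlgHom.norm_apply_le ι _).trans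
      ((ContinuousMap.norm_le _ (norm_nonneg _)).2 (P.norm_tower_apply_le k f))
  · rw [hθ, hθ, ← map_mul, P.tower_mul_tower hfh, map_zero]
  · have hσc : Continuous σ := (AddMonoidHomClass.lipschitz_of_bound σ 1 fun x => by
      simpa using NonUnitalStarAlgHom.norm_apply_le σ x).continuous
    have hσD : ∀ x : D, σ x ∈ D := by
      have hle : D ≤ D.comap σ := D₀.topologicalClosure_minimal (StarAlgebra.adjoin_le (by
        rintro _ (⟨i, f, rfl⟩ | ⟨i, f, rfl⟩)
        · change σ (φ i f) ∈ D
          rw [← hσφ]; exact hφD _ _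
        · change σ (ψ i f) ∈ D
          rw [← hσψ]; exact hψD _ _)) (hD.preimage hσc)
      exact fun x => hle x.2
    let τ : D →⋆ₐ[ℂ] D := (σ.comp D.subtype).codRestrict D hσD
    let κ := WeakDual.CharacterSpace.compContinuousMap τ
    have hκ : ∀ (x : D) χ, Γ x (κ χ) = Γ (τ x) χ := fun _ _ => rfl
    have key : P.tower k (translate (g, h) f) = Γ (τ (Γ.symm (P.tower k f))) := by
      ext χ
      rw [← hκ, StarAlgEquiv.apply_symm_apply]
      refine (P.tower_equivariant κ g h (fun i f χ => ?_) (fun j f χ => ?_) k f χ).symm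
      · rw [← hPx, ← hPx, hφ', hφ', hκ]
        congr 2
        exact Subtype.ext (hσφ i f).symm
      · rw [← hPz, ← hPz, hψ', hψ', hκ]
        congr 2
        exact Subtype.ext (hσψ j f).symm
    rw [hθ, hθ, key]
    change ((Γ.symm (Γ (τ (Γ.symm (P.tower k f)))) : D) : F) = _
    rw [StarAlgEquiv.symm_apply_apply]
    rfl
  · rw [hθ, hθ, ← map_mul, ← map_mul, mul_comm]
  · simp only [hθ, ← map_sum, P.sum_tower_one, map_one]

end Abstract

/-! ### Central sequences -/

open Filter ClosedStarIdeal

section CentralBdd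

variable {A : Type*} [NonUnitalCStarAlgebra A]

theorem mk_nullSeq_eq_zero {x : BddSeq A} :
    QuotAlg.mk (nullSeq A) x = 0 ↔ Tendsto (fun n => x n) atTop (𝓝 0) := by
  rw [← map_zero (QuotAlg.mk (nullSeq A))]
  refine (QuotAlg.mkL_eq_iff (I := nullSeq A)).trans ?_
  rw [sub_zero]
  rfl

variable (A) in
/-- The bounded sequences in `A` that asymptotically commute with every element of `A`. -/
def CentralBdd : NonUnitalStarSubalgebra ℂ (BddSeq A) :=
  (CentralSeq A).comap (QuotAlg.mk (nullSeq A))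

theorem mem_centralBdd {x : BddSeq A} :
    x ∈ CentralBdd A ↔ ∀ a, Tendsto (fun n => a * x n - x n * a) atTop (𝓝 0) := by
  refine CentralSeq.mem_iff.trans (forall_congr' fun a => ?_)
  rw [← sub_eq_zero]
  exact mk_nullSeq_eq_zero (x := constSeq A a * x - x * constSeq A a)

variable (A) in
/-- The class in `F_∞(A)` of a central sequence. -/
def cls : CentralBdd A →⋆ₙₐ[ℂ] FInf A :=
  (QuotAlg.mk (annihilator A)).comp (NonUnitalStarAlgHom.codRestrict
    ((QuotAlg.mk (nullSeq A)).comp (NonUnitalStarSubalgebraClass.subtype (CentralBdd A)))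
    (CentralSeq A) fun x => x.2)

theorem cls_surjective : Function.Surjective (cls A) := fun ξ => by
  obtain ⟨⟨x, hx⟩, rfl⟩ := QuotAlg.mk_surjective ξ
  obtain ⟨x, rfl⟩ := QuotAlg.mk_surjective x
  exact ⟨⟨x, hx⟩, rfl⟩

theorem cls_eq_iff {x y : CentralBdd A} :
    cls A x = cls A y ↔
      ∀ a, Tendsto (fun n => ((x : BddSeq A) n - (y : BddSeq A) n) * a) atTop (𝓝 0) := by
  refine (QuotAlg.mkL_eq_iff (I := annihilator A)).trans (forall_congr' fun a => ?_)
  exact mk_nullSeq_eq_zero (x := ((x : BddSeq A) - (y : BddSeq A)) * constSeq A a)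

/-- The coordinatewise action of an automorphism on central sequences. -/
def CentralBdd.map (e : A ≃⋆ₐ[ℂ] A) (x : CentralBdd A) : CentralBdd A :=
  ⟨BddSeq.map e x, (CentralSeq.map e ⟨QuotAlg.mk (nullSeq A) x, x.2⟩).2⟩

theorem FInf.map_cls (e : A ≃⋆ₐ[ℂ] A) (x : CentralBdd A) :
    FInf.map e (cls A x) = cls A (CentralBdd.map e x) := rfl

theorem tendsto_zero_mul_of_bdd {x : ℕ → A} (hx : Tendsto x atTop (𝓝 0)) (y : BddSeq A) :
    Tendsto (fun n => x n * y n) atTop (𝓝 0) := by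
  have h := (tendsto_zero_iff_norm_tendsto_zero.1 hx).mul_const ‖y‖
  rw [zero_mul] at h
  exact squeeze_zero_norm (fun n => (norm_mul_le _ _).trans
    (mul_le_mul_of_nonneg_left (y.norm_apply_le n) (norm_nonneg _))) h

theorem tendsto_zero_bdd_mul {x : ℕ → A} (hx : Tendsto x atTop (𝓝 0)) (y : BddSeq A) :
    Tendsto (fun n => y n * x n) atTop (𝓝 0) := by
  have h := (tendsto_zero_iff_norm_tendsto_zero.1 hx).const_mul ‖y‖
  rw [mul_zero] at h
  exact squeeze_zero_norm (fun n => (norm_mul_le _ _).trans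
    (mul_le_mul_of_nonneg_right (y.norm_apply_le n) (norm_nonneg _))) h

/-- An equi-Lipschitz sequence of maps that tends to zero on a dense set tends to zero
everywhere. -/
theorem tendsto_zero_of_dense {E : Type*} [SeminormedAddCommGroup E] {L : ℕ → E → A} {C : ℝ}
    (hL : ∀ n c d, ‖L n c - L n d‖ ≤ C * ‖c - d‖) {s : Set E} (hs : Dense s)
    (h : ∀ c ∈ s, Tendsto (fun n => L n c) atTop (𝓝 0)) (c : E) :
    Tendsto (fun n => L n c) atTop (𝓝 0) := by
  refine Metric.tendsto_atTop.2 fun ε hε => ?_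
  have hC : 0 < |C| + 1 := by positivity
  obtain ⟨d, hd, hcd⟩ := Metric.mem_closure_iff.1 (hs c) (ε / 2 / (|C| + 1)) (by positivity)
  obtain ⟨N, hN⟩ := Metric.tendsto_atTop.1 (h d hd) (ε / 2) (half_pos hε)
  refine ⟨N, fun n hn => ?_⟩
  have h1 := hN n hn
  rw [dist_zero_right] at h1 ⊢
  rw [dist_eq_norm, lt_div_iff₀ hC] at hcd
  have h2 : C * ‖c - d‖ ≤ ‖c - d‖ * (|C| + 1) := by
    rw [mul_comm]
    exact mul_le_mul_of_nonneg_left (by linarith [le_abs_self C]) (norm_nonneg _)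
  calc ‖L n c‖ = ‖L n c - L n d + L n d‖ := by rw [sub_add_cancel]
    _ ≤ ‖L n c - L n d‖ + ‖L n d‖ := norm_add_le _ _
    _ < ε := by linarith [hL n c d]

variable (A) in
/-- A separable C⋆-algebra has a sequential two-sided approximate unit. -/
theorem exists_seq_approximateUnit [TopologicalSpace.SeparableSpace A] :
    ∃ u : BddSeq A, ∀ a, Tendsto (fun n => u n * a - a) atTop (𝓝 0) ∧
      Tendsto (fun n => a * u n - a) atTop (𝓝 0) := by
  let _ : PartialOrder A := CStarAlgebra.spectralOrder A
  have _ : StarOrderedRing A := CStarAlgebra.spectralOrderedRing A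
  have hl := CStarAlgebra.increasingApproximateUnit A
  let d : ℕ → A := TopologicalSpace.denseSeq A
  have step : ∀ n : ℕ, ∃ e : A, ‖e‖ ≤ 1 ∧
      ∀ k ∈ Finset.range n, ‖e * d k - d k‖ < 1 / (n + 1 : ℝ) ∧ ‖d k * e - d k‖ < 1 / (n + 1 : ℝ) :=
    fun n => by
      refine (hl.eventually_norm.and ((Filter.eventually_all_finset _).2 fun k _ => ?_)).exists
      have h1 := (hl.tendsto_mul_right (d k)).sub_const (d k)
      have h2 := (hl.tendsto_mul_left (d k)).sub_const (d k)
      rw [sub_self] at h1 h2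
      have h3 := h1.norm
      have h4 := h2.norm
      rw [norm_zero] at h3 h4
      exact (h3.eventually_lt_const Nat.one_div_pos_of_nat).and
        (h4.eventually_lt_const Nat.one_div_pos_of_nat)
  choose e he1 he using step
  let u : BddSeq A := ⟨e, memℓp_infty ⟨1, by rintro _ ⟨n, rfl⟩; exact he1 n⟩⟩
  have hlim : ∀ (L : ℕ → A) (k : ℕ), (∀ n, k < n → ‖L n‖ < 1 / (n + 1 : ℝ)) →
      Tendsto L atTop (𝓝 0) := fun L k hL => by
    refine squeeze_zero_norm' ?_ tendsto_one_div_add_atTop_nhds_zero_nat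
    filter_upwards [eventually_gt_atTop k] with n hn using (hL n hn).le
  refine ⟨u, fun a => ⟨?_, ?_⟩⟩
  · refine tendsto_zero_of_dense (L := fun n a => e n * a - a) (C := 2) (fun n c d => ?_)
      (TopologicalSpace.denseRange_denseSeq A) ?_ a
    · have : e n * c - c - (e n * d - d) = e n * (c - d) - (c - d) := by noncomm_ring
      rw [this]
      refine (norm_sub_le _ _).trans ?_
      have := (norm_mul_le (e n) (c - d)).trans (mul_le_mul_of_nonneg_right (he1 n) (norm_nonneg _))
      linarith
    · rintro _ ⟨k, rfl⟩
      exact hlim _ k fun n hn => (he n k (Finset.mem_range.2 hn)).1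
  · refine tendsto_zero_of_dense (L := fun n a => a * e n - a) (C := 2) (fun n c d => ?_)
      (TopologicalSpace.denseRange_denseSeq A) ?_ a
    · have : c * e n - c - (d * e n - d) = (c - d) * e n - (c - d) := by noncomm_ring
      rw [this]
      refine (norm_sub_le _ _).trans ?_
      have := (norm_mul_le (c - d) (e n)).trans (mul_le_mul_of_nonneg_left (he1 n) (norm_nonneg _))
      linarith
    · rintro _ ⟨k, rfl⟩
      exact hlim _ k fun n hn => (he n k (Finset.mem_range.2 hn)).2

/-- Representatives of the unit of `F_∞(A)` are approximate units of `A`. -/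
theorem tendsto_unit_mul [TopologicalSpace.SeparableSpace A] {e : CentralBdd A}
    (he : ∀ ξ, cls A e * ξ = ξ) (a : A) :
    Tendsto (fun n => (e : BddSeq A) n * a - a) atTop (𝓝 0) := by
  obtain ⟨u, hu⟩ := exists_seq_approximateUnit A
  have huc : u ∈ CentralBdd A := mem_centralBdd.2 fun a => by
    have := (hu a).2.sub (hu a).1
    simpa using this
  have h1 := he (cls A ⟨u, huc⟩)
  rw [← map_mul, cls_eq_iff] at h1
  have h2 := tendsto_zero_bdd_mul (hu a).1 (e : BddSeq A)
  have h3 := ((h1 a).sub h2).add (hu a).1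
  rw [sub_zero, zero_add] at h3
  refine h3.congr fun n => ?_
  change ((e : BddSeq A) n * u n - u n) * a - (e : BddSeq A) n * (u n * a - a) + (u n * a - a) = _
  noncomm_ring

end CentralBdd

/-! ### Tensor products of central sequences -/

section Tensor

variable {A B : Type*} [NonUnitalCStarAlgebra A] [NonUnitalCStarAlgebra B]

namespace MaxTensor

theorem add_tmul (a a' : A) (b : B) : tmul (a + a') b = tmul a b + tmul a' b := by
  rw [tmul, AlgTensor.add_tmul, map_add]; rfl

theorem tmul_add (a : A) (b b' : B) : tmul a (b + b') = tmul a b + tmul a b' := by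
  rw [tmul, AlgTensor.tmul_add, map_add]; rfl

theorem smul_tmul (c : ℂ) (a : A) (b : B) : tmul (c • a) b = c • tmul a b :=
  map_smul of c (AlgTensor.tmul a b)

theorem tmul_smul (c : ℂ) (a : A) (b : B) : tmul a (c • b) = c • tmul a b := by
  rw [tmul, tmul, ← map_smul]
  exact congrArg _ (TensorProduct.tmul_smul c a b)

theorem sub_tmul (a a' : A) (b : B) : tmul (a - a') b = tmul a b - tmul a' b := by
  rw [eq_sub_iff_add_eq, ← add_tmul, sub_add_cancel]

theorem tmul_sub (a : A) (b b' : B) : tmul a (b - b') = tmul a b - tmul a b' := by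
  rw [eq_sub_iff_add_eq, ← tmul_add, sub_add_cancel]

theorem tmul_mul_tmul (a a' : A) (b b' : B) :
    tmul a b * tmul a' b' = tmul (a * a') (b * b') := by
  rw [tmul, tmul, ← of_mul, AlgTensor.tmul_mul]; rfl

theorem star_tmul (a : A) (b : B) : star (tmul a b) = tmul (star a) (star b) := by
  rw [tmul, ← of_star, AlgTensor.star_tmul]; rfl

/-- A uniformly bounded sequence of additive maps on `A ⊗_max B` tends to zero pointwise if it does so
on elementary tensors. -/
theorem tendsto_zero {E : Type*} [NonUnitalCStarAlgebra E] (L : ℕ → MaxTensor A B →+ E) (C : ℝ)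
    (hL : ∀ n c, ‖L n c‖ ≤ C * ‖c‖)
    (h : ∀ a b, Tendsto (fun n => L n (tmul a b)) atTop (𝓝 0)) (c : MaxTensor A B) :
    Tendsto (fun n => L n c) atTop (𝓝 0) := by
  refine tendsto_zero_of_dense (L := fun n c => L n c) (C := C)
    (fun n c d => by rw [← map_sub]; exact hL n _)
    (s := Set.range (of : AlgTensor A B → MaxTensor A B)) denseInducing_of.dense ?_ c
  rintro _ ⟨y, rfl⟩
  induction y using AlgTensor.induction with
  | h0 => simp
  | h1 a b => exact h a b
  | h2 y z hy hz => simpa using hy.add hz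

theorem tendsto_tmul_left {x : ℕ → A} (hx : Tendsto x atTop (𝓝 0)) (y : BddSeq B) :
    Tendsto (fun n => tmul (x n) (y n)) atTop (𝓝 0) := by
  have h := (tendsto_zero_iff_norm_tendsto_zero.1 hx).mul_const ‖y‖
  rw [zero_mul] at h
  exact squeeze_zero_norm (fun n => (norm_tmul_le _ _).trans
    (mul_le_mul_of_nonneg_left (y.norm_apply_le n) (norm_nonneg _))) h

theorem tendsto_tmul_right (x : BddSeq A) {y : ℕ → B} (hy : Tendsto y atTop (𝓝 0)) :
    Tendsto (fun n => tmul (x n) (y n)) atTop (𝓝 0) := by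
  have h := (tendsto_zero_iff_norm_tendsto_zero.1 hy).const_mul ‖x‖
  rw [mul_zero] at h
  exact squeeze_zero_norm (fun n => (norm_tmul_le _ _).trans
    (mul_le_mul_of_nonneg_right (x.norm_apply_le n) (norm_nonneg _))) h

end MaxTensor

open MaxTensor

/-- The coordinatewise tensor product of bounded sequences. -/
def BddSeq.tmul (x : BddSeq A) (y : BddSeq B) : BddSeq (MaxTensor A B) :=
  ⟨fun n => MaxTensor.tmul (x n) (y n), memℓp_infty ⟨‖x‖ * ‖y‖, by
    rintro _ ⟨n, rfl⟩
    exact (norm_tmul_le _ _).trans (mul_le_mul (x.norm_apply_le n) (y.norm_apply_le n)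
      (norm_nonneg _) (norm_nonneg _))⟩⟩

theorem BddSeq.tmul_mem {x : BddSeq A} (hx : x ∈ CentralBdd A) {y : BddSeq B}
    (hy : y ∈ CentralBdd B) : BddSeq.tmul x y ∈ CentralBdd (MaxTensor A B) := by
  rw [mem_centralBdd] at hx hy ⊢
  set z := BddSeq.tmul x y with hz
  refine MaxTensor.tendsto_zero (fun n => AddMonoidHom.mulRight (z n) - AddMonoidHom.mulLeft (z n))
    (2 * ‖z‖) (fun n c => ?_) fun a b => ?_
  · have h1 := z.norm_apply_le n
    calc ‖c * z n - z n * c‖ ≤ ‖c‖ * ‖z n‖ + ‖z n‖ * ‖c‖ :=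
          (norm_sub_le _ _).trans (add_le_add (norm_mul_le _ _) (norm_mul_le _ _))
      _ ≤ ‖c‖ * ‖z‖ + ‖z‖ * ‖c‖ := by gcongr
      _ = 2 * ‖z‖ * ‖c‖ := by ring
  · have h1 := tendsto_tmul_left (hx a) (constSeq B b * y)
    have h2 := tendsto_tmul_right (x * constSeq A a) (hy b)
    have h3 := h1.add h2
    rw [zero_add] at h3
    refine h3.congr fun n => ?_
    change MaxTensor.tmul (a * x n - x n * a) (b * y n) +
      MaxTensor.tmul (x n * a) (b * y n - y n * b) =
      MaxTensor.tmul a b * MaxTensor.tmul (x n) (y n) -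
        MaxTensor.tmul (x n) (y n) * MaxTensor.tmul a b
    rw [sub_tmul, tmul_sub, tmul_mul_tmul, tmul_mul_tmul]
    abel

/-- The coordinatewise tensor product of central sequences. -/
def CentralBdd.tmul (x : CentralBdd A) (y : CentralBdd B) : CentralBdd (MaxTensor A B) :=
  ⟨BddSeq.tmul x y, BddSeq.tmul_mem x.2 y.2⟩

theorem cls_tmul_congr {x x' : CentralBdd A} {y y' : CentralBdd B} (hx : cls A x = cls A x')
    (hy : cls B y = cls B y') :
    cls _ (CentralBdd.tmul x y) = cls _ (CentralBdd.tmul x' y') := by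
  rw [cls_eq_iff] at hx hy ⊢
  set z := CentralBdd.tmul x y - CentralBdd.tmul x' y' with hz
  refine MaxTensor.tendsto_zero (fun n => AddMonoidHom.mulLeft ((z : BddSeq (MaxTensor A B)) n))
    ‖z‖ (fun n c => ?_) fun a b => ?_
  · exact (norm_mul_le _ _).trans (mul_le_mul_of_nonneg_right
      (BddSeq.norm_apply_le (z : BddSeq (MaxTensor A B)) n) (norm_nonneg _))
  · have h1 := tendsto_tmul_left (hx a) ((y : BddSeq B) * constSeq B b)
    have h2 := tendsto_tmul_right ((x' : BddSeq A) * constSeq A a) (hy b)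
    have h3 := h1.add h2
    rw [zero_add] at h3
    refine h3.congr fun n => ?_
    change MaxTensor.tmul (((x : BddSeq A) n - (x' : BddSeq A) n) * a) ((y : BddSeq B) n * b) +
      MaxTensor.tmul ((x' : BddSeq A) n * a) (((y : BddSeq B) n - (y' : BddSeq B) n) * b) =
      (MaxTensor.tmul ((x : BddSeq A) n) ((y : BddSeq B) n) -
        MaxTensor.tmul ((x' : BddSeq A) n) ((y' : BddSeq B) n)) * MaxTensor.tmul a b
    simp only [sub_mul, sub_tmul, tmul_sub, tmul_mul_tmul]
    abel

/-- The product `F_∞(A) × F_∞(B) → F_∞(A ⊗_max B)` induced by the tensor product of representing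
sequences. -/
def FInf.tmul (ξ : FInf A) (η : FInf B) : FInf (MaxTensor A B) :=
  cls _ (CentralBdd.tmul (cls_surjective ξ).choose (cls_surjective η).choose)

theorem FInf.tmul_cls (x : CentralBdd A) (y : CentralBdd B) :
    FInf.tmul (cls A x) (cls B y) = cls _ (CentralBdd.tmul x y) :=
  cls_tmul_congr (cls_surjective (cls A x)).choose_spec (cls_surjective (cls B y)).choose_spec

namespace FInf

theorem add_tmul (ξ ξ' : FInf A) (η : FInf B) : tmul (ξ + ξ') η = tmul ξ η + tmul ξ' η := by
  obtain ⟨x, rfl⟩ := cls_surjective ξ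
  obtain ⟨x', rfl⟩ := cls_surjective ξ'
  obtain ⟨y, rfl⟩ := cls_surjective η
  rw [← map_add, tmul_cls, tmul_cls, tmul_cls, ← map_add]
  exact congrArg _ (Subtype.ext (by ext n; exact MaxTensor.add_tmul _ _ _))

theorem tmul_add (ξ : FInf A) (η η' : FInf B) : tmul ξ (η + η') = tmul ξ η + tmul ξ η' := by
  obtain ⟨x, rfl⟩ := cls_surjective ξ
  obtain ⟨y, rfl⟩ := cls_surjective η
  obtain ⟨y', rfl⟩ := cls_surjective η'
  rw [← map_add, tmul_cls, tmul_cls, tmul_cls, ← map_add]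
  exact congrArg _ (Subtype.ext (by ext n; exact MaxTensor.tmul_add _ _ _))

theorem smul_tmul (c : ℂ) (ξ : FInf A) (η : FInf B) : tmul (c • ξ) η = c • tmul ξ η := by
  obtain ⟨x, rfl⟩ := cls_surjective ξ
  obtain ⟨y, rfl⟩ := cls_surjective η
  rw [← map_smul, tmul_cls, tmul_cls, ← map_smul]
  exact congrArg _ (Subtype.ext (by ext n; exact MaxTensor.smul_tmul _ _ _))

theorem tmul_smul (c : ℂ) (ξ : FInf A) (η : FInf B) : tmul ξ (c • η) = c • tmul ξ η := by
  obtain ⟨x, rfl⟩ := cls_surjective ξ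
  obtain ⟨y, rfl⟩ := cls_surjective η
  rw [← map_smul, tmul_cls, tmul_cls, ← map_smul]
  exact congrArg _ (Subtype.ext (by ext n; exact MaxTensor.tmul_smul _ _ _))

theorem tmul_mul_tmul (ξ ξ' : FInf A) (η η' : FInf B) :
    tmul ξ η * tmul ξ' η' = tmul (ξ * ξ') (η * η') := by
  obtain ⟨x, rfl⟩ := cls_surjective ξ
  obtain ⟨y, rfl⟩ := cls_surjective η
  obtain ⟨x', rfl⟩ := cls_surjective ξ'
  obtain ⟨y', rfl⟩ := cls_surjective η'
  rw [← map_mul, ← map_mul, tmul_cls, tmul_cls, tmul_cls, ← map_mul]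
  exact congrArg _ (Subtype.ext (by ext n; exact MaxTensor.tmul_mul_tmul _ _ _ _))

theorem star_tmul (ξ : FInf A) (η : FInf B) : star (tmul ξ η) = tmul (star ξ) (star η) := by
  obtain ⟨x, rfl⟩ := cls_surjective ξ
  obtain ⟨y, rfl⟩ := cls_surjective η
  rw [← map_star, ← map_star, tmul_cls, tmul_cls, ← map_star]
  exact congrArg _ (Subtype.ext (by ext n; exact MaxTensor.star_tmul _ _))

theorem map_autMap_tmul (e : A ≃⋆ₐ[ℂ] A) (f : B ≃⋆ₐ[ℂ] B) (ξ : FInf A) (η : FInf B) :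
    FInf.map (MaxTensor.autMap e f) (tmul ξ η) = tmul (FInf.map e ξ) (FInf.map f η) := by
  obtain ⟨x, rfl⟩ := cls_surjective ξ
  obtain ⟨y, rfl⟩ := cls_surjective η
  rw [map_cls, map_cls, tmul_cls, tmul_cls, map_cls]
  exact congrArg _ (Subtype.ext (by ext n; exact MaxTensor.autMap_tmul _ _ _ _))

/-- The tensor product of the units of `F_∞(A)` and `F_∞(B)` is the unit of `F_∞(A ⊗_max B)`. -/
theorem tmul_unit [TopologicalSpace.SeparableSpace A] [TopologicalSpace.SeparableSpace B]
    {u : FInf A} (hu : ∀ ξ, u * ξ = ξ) {v : FInf B} (hv : ∀ η, v * η = η)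
    (ζ : FInf (MaxTensor A B)) : tmul u v * ζ = ζ ∧ ζ * tmul u v = ζ := by
  obtain ⟨x, rfl⟩ := cls_surjective u
  obtain ⟨y, rfl⟩ := cls_surjective v
  obtain ⟨z, rfl⟩ := cls_surjective ζ
  rw [tmul_cls, ← map_mul, ← map_mul, cls_eq_iff, cls_eq_iff]
  set w := CentralBdd.tmul x y with hw
  have hunit : ∀ c : MaxTensor A B,
      Tendsto (fun n => (w : BddSeq (MaxTensor A B)) n * c - c) atTop (𝓝 0) := by
    refine MaxTensor.tendsto_zero (fun n => AddMonoidHom.mulLeft ((w : BddSeq (MaxTensor A B)) n) -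
      AddMonoidHom.id _) (‖w‖ + 1) (fun n c => ?_) fun a b => ?_
    · change ‖(w : BddSeq (MaxTensor A B)) n * c - c‖ ≤ _
      have := (norm_mul_le ((w : BddSeq (MaxTensor A B)) n) c).trans
        (mul_le_mul_of_nonneg_right (BddSeq.norm_apply_le (w : BddSeq (MaxTensor A B)) n)
          (norm_nonneg _))
      refine (norm_sub_le _ _).trans ?_
      rw [add_mul, one_mul]
      exact add_le_add this le_rfl
    · have h1 := tendsto_tmul_left (tendsto_unit_mul hu a) ((y : BddSeq B) * constSeq B b)
      have h2 := tendsto_tmul_right (constSeq A a) (tendsto_unit_mul hv b)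
      have h3 := h1.add h2
      rw [zero_add] at h3
      refine h3.congr fun n => ?_
      change MaxTensor.tmul ((x : BddSeq A) n * a - a) ((y : BddSeq B) n * b) +
        MaxTensor.tmul a ((y : BddSeq B) n * b - b) =
        MaxTensor.tmul ((x : BddSeq A) n) ((y : BddSeq B) n) * MaxTensor.tmul a b -
          MaxTensor.tmul a b
      rw [MaxTensor.sub_tmul, MaxTensor.tmul_sub, MaxTensor.tmul_mul_tmul]
      abel
  have hz := mem_centralBdd.1 z.2
  refine ⟨fun c => ?_, fun c => ?_⟩
  · have h1 := tendsto_zero_bdd_mul (hz c) (w : BddSeq (MaxTensor A B))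
    have h2 := tendsto_zero_mul_of_bdd (hunit c) (z : BddSeq (MaxTensor A B))
    have h3 := (h2.sub h1).add (hz c)
    rw [sub_zero, zero_add] at h3
    refine h3.congr fun n => ?_
    change _ = ((w : BddSeq (MaxTensor A B)) n * (z : BddSeq (MaxTensor A B)) n -
      (z : BddSeq (MaxTensor A B)) n) * c
    noncomm_ring
  · refine (tendsto_zero_bdd_mul (hunit c) (z : BddSeq (MaxTensor A B))).congr fun n => ?_
    change _ = ((z : BddSeq (MaxTensor A B)) n * (w : BddSeq (MaxTensor A B)) n -
      (z : BddSeq (MaxTensor A B)) n) * c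
    noncomm_ring

end FInf

end Tensor

/-! ### Rokhlin dimension of the product action -/

section Final

variable {G : Type*} [Group G] [TopologicalSpace G] [IsTopologicalGroup G] [CompactSpace G]
  [T2Space G]
  {H : Type*} [Group H] [TopologicalSpace H] [IsTopologicalGroup H] [CompactSpace H] [T2Space H]
  {a b : ℕ}

/-- `exists_product_towers` for an algebra whose unit is given by an element. -/
theorem exists_product_towers_of_unit {F : Type*} [NonUnitalCStarAlgebra F] (u : F)
    (hu : ∀ x, u * x = x ∧ x * u = x)
    (φ : Fin (a + 1) → C(G, ℂ) →ₗ[ℂ] F) (ψ : Fin (b + 1) → C(H, ℂ) →ₗ[ℂ] F)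
    (hφs : ∀ i f, φ i (star f) = star (φ i f)) (hψs : ∀ j f, ψ j (star f) = star (ψ j f))
    (hφm : ∀ i f h, φ i f * φ i h = φ i (f * h) * φ i 1)
    (hψm : ∀ j f h, ψ j f * ψ j h = ψ j (f * h) * ψ j 1)
    (hφ0 : ∀ i, ∃ n, φ i 1 = star n * n) (hψ0 : ∀ j, ∃ n, ψ j 1 = star n * n)
    (hφ1 : ∑ i, φ i 1 = u) (hψ1 : ∑ j, ψ j 1 = u)
    (hφφ : ∀ i j f h, φ i f * φ j h = φ j h * φ i f)
    (hψψ : ∀ i j f h, ψ i f * ψ j h = ψ j h * ψ i f)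
    (hφψ : ∀ i j f h, φ i f * ψ j h = ψ j h * φ i f) :
    ∃ θ : Fin (a + b + 1) → C(G × H, ℂ) →ₗ[ℂ] F,
      (∀ k, IsCompletelyPositive (θ k)) ∧
      (∀ k f, ‖θ k f‖ ≤ ‖f‖) ∧
      (∀ k f h, f * h = 0 → θ k f * θ k h = 0) ∧
      (∀ (σ : F →⋆ₙₐ[ℂ] F) (g : G) (h : H), σ u = u → (∀ i f, φ i (translate g f) = σ (φ i f)) →
        (∀ j f, ψ j (translate h f) = σ (ψ j f)) →
        ∀ k f, θ k (translate (g, h) f) = σ (θ k f)) ∧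
      (∀ k l f h, θ k f * θ l h = θ l h * θ k f) ∧
      ∑ k, θ k 1 = u := by
  let _ : CStarAlgebra F := cstarAlgebraOfUnit F u hu
  obtain ⟨θ, h1, h2, h3, h4, h5, h6⟩ := exists_product_towers φ ψ hφs hψs hφm hψm hφ0 hψ0
    hφ1 hψ1 hφφ hψψ hφψ
  refine ⟨θ, h1, h2, h3, fun σ g h hσ hσφ hσψ => ?_, h5, h6⟩
  let σ' : F →⋆ₐ[ℂ] F :=
    { toFun := σ
      map_one' := hσ
      map_mul' := map_mul σ
      map_zero' := map_zero σ
      map_add' := map_add σ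
      commutes' := fun c => by
        rw [Algebra.algebraMap_eq_smul_one]
        exact (map_smul σ c u).trans (congrArg (c • ·) hσ)
      map_star' := map_star σ }
  exact h4 σ' g h hσφ hσψ

omit [CompactSpace G] [T2Space G] in
theorem translate_one (g : G) : translate g (1 : C(G, ℂ)) = 1 := rfl

omit [CompactSpace G] [T2Space G] in
/-- The left translation action on `C(G)` is norm continuous. -/
theorem continuous_translate (f : C(G, ℂ)) : Continuous fun g => translate g f :=
  ContinuousMap.continuous_of_continuous_uncurry _ (by
    change Continuous fun p : G × G => f (p.1⁻¹ * p.2)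
    fun_prop)

theorem rokhlinDimCLE_prod {A B : Type*} [NonUnitalCStarAlgebra A]
    [TopologicalSpace.SeparableSpace A] [NonUnitalCStarAlgebra B]
    [TopologicalSpace.SeparableSpace B] {α : CStarAction G A} {β : CStarAction H B}
    (hα : RokhlinDimCLE α a) (hβ : RokhlinDimCLE β b) : RokhlinDimCLE (α.prod β) (a + b) := by
  obtain ⟨φ, -, hφcp, hφn, hφz, hφe, hφc, hφ1⟩ := hα
  obtain ⟨ψ, -, hψcp, hψn, hψz, hψe, hψc, hψ1⟩ := hβ
  have hφm := fun i => orderZero_mul (φ i) (hφn i) (hφz i)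
  have hψm := fun j => orderZero_mul (ψ j) (hψn j) (hψz j)
  set u : FInf A := ∑ i, φ i 1 with hu
  set v : FInf B := ∑ j, ψ j 1 with hv
  have hustar : star u = u := by
    rw [hu, star_sum]
    exact Finset.sum_congr rfl fun i _ => by rw [← (hφcp i).map_star, star_one]
  have hvstar : star v = v := by
    rw [hv, star_sum]
    exact Finset.sum_congr rfl fun j _ => by rw [← (hψcp j).map_star, star_one]
  have hφφ : ∀ i j f h, φ i f * φ j h = φ j h * φ i f := fun i j f h => by
    rcases eq_or_ne i j with rfl | hij
    · rw [hφm i f h, hφm i h f, mul_comm f h]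
    · exact hφc i j hij f h
  have hψψ : ∀ i j f h, ψ i f * ψ j h = ψ j h * ψ i f := fun i j f h => by
    rcases eq_or_ne i j with rfl | hij
    · rw [hψm i f h, hψm i h f, mul_comm f h]
    · exact hψc i j hij f h
  let Φ : FInf A →ₗ[ℂ] FInf (MaxTensor A B) :=
    { toFun := fun ξ => FInf.tmul ξ v
      map_add' := fun ξ ξ' => FInf.add_tmul ξ ξ' v
      map_smul' := fun c ξ => FInf.smul_tmul c ξ v }
  let Ψ : FInf B →ₗ[ℂ] FInf (MaxTensor A B) :=
    { toFun := fun η => FInf.tmul u η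
      map_add' := fun η η' => FInf.tmul_add u η η'
      map_smul' := fun c η => FInf.tmul_smul c u η }
  have hΦ : ∀ ξ, Φ ξ = FInf.tmul ξ v := fun _ => rfl
  have hΨ : ∀ η, Ψ η = FInf.tmul u η := fun _ => rfl
  have hΦm : ∀ ξ ξ', Φ ξ * Φ ξ' = Φ (ξ * ξ') := fun ξ ξ' => by
    rw [hΦ, hΦ, FInf.tmul_mul_tmul, (hψ1 v).1, hΦ]
  have hΨm : ∀ η η', Ψ η * Ψ η' = Ψ (η * η') := fun η η' => by
    rw [hΨ, hΨ, FInf.tmul_mul_tmul, (hφ1 u).1, hΨ]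
  have hΦs : ∀ ξ, star (Φ ξ) = Φ (star ξ) := fun ξ => by rw [hΦ, FInf.star_tmul, hvstar, hΦ]
  have hΨs : ∀ η, star (Ψ η) = Ψ (star η) := fun η => by rw [hΨ, FInf.star_tmul, hustar, hΨ]
  have huα : ∀ g, FInf.map (α.aut g) u = u := fun g => by
    rw [hu, map_sum]
    exact Finset.sum_congr rfl fun i _ => by rw [← hφe, translate_one]
  have hvβ : ∀ h, FInf.map (β.aut h) v = v := fun h => by
    rw [hv, map_sum]
    exact Finset.sum_congr rfl fun j _ => by rw [← hψe, translate_one]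
  obtain ⟨θ, hcp, hn, hz, he, hc, h1⟩ := exists_product_towers_of_unit (FInf.tmul u v)
    (FInf.tmul_unit (fun ξ => (hφ1 ξ).1) (fun η => (hψ1 η).1))
    (fun i => Φ.comp (φ i)) (fun j => Ψ.comp (ψ j))
    (fun i f => by
      simp only [LinearMap.comp_apply]; rw [(hφcp i).map_star, hΦs])
    (fun j f => by
      simp only [LinearMap.comp_apply]; rw [(hψcp j).map_star, hΨs])
    (fun i f h => by
      simp only [LinearMap.comp_apply]; rw [hΦm, hΦm, hφm])
    (fun j f h => by
      simp only [LinearMap.comp_apply]; rw [hΨm, hΨm, hψm])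
    (fun i => by
      obtain ⟨n, hn⟩ := (hφcp i).exists_map_one
      exact ⟨Φ n, by rw [LinearMap.comp_apply, hn, hΦs, hΦm]⟩)
    (fun j => by
      obtain ⟨n, hn⟩ := (hψcp j).exists_map_one
      exact ⟨Ψ n, by rw [LinearMap.comp_apply, hn, hΨs, hΨm]⟩)
    (by simp only [LinearMap.comp_apply]; rw [← map_sum]; rfl)
    (by simp only [LinearMap.comp_apply]; rw [← map_sum]; rfl)
    (fun i j f h => by
      simp only [LinearMap.comp_apply]; rw [hΦm, hΦm, hφφ])
    (fun i j f h => by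
      simp only [LinearMap.comp_apply]; rw [hΨm, hΨm, hψψ])
    (fun i j f h => by
      simp only [LinearMap.comp_apply]
      rw [hΦ, hΨ, FInf.tmul_mul_tmul, FInf.tmul_mul_tmul, (hφ1 _).1, (hφ1 _).2, (hψ1 _).1,
        (hψ1 _).2])
  have heq : ∀ k (q : G × H) f,
      θ k (translate q f) = FInf.map ((α.prod β).aut q) (θ k f) := fun k q f => by
    have hmap : ∀ ξ η, FInf.map ((α.prod β).aut q) (FInf.tmul ξ η) =
        FInf.tmul (FInf.map (α.aut q.1) ξ) (FInf.map (β.aut q.2) η) := fun ξ η =>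
      FInf.map_autMap_tmul _ _ ξ η
    refine he _ q.1 q.2 ?_ (fun i f => ?_) (fun j f => ?_) k f
    · rw [hmap, huα, hvβ]
    · rw [LinearMap.comp_apply, LinearMap.comp_apply, hΦ, hΦ, hmap, hvβ, hφe]
    · rw [LinearMap.comp_apply, LinearMap.comp_apply, hΨ, hΨ, hmap, huα, hψe]
  refine ⟨θ, fun k f => ?_, hcp, hn, hz, heq, fun k l _ f h => hc k l f h, fun x => ?_⟩
  · have hcont : Continuous (θ k) := (AddMonoidHomClass.lipschitz_of_bound (θ k) 1 fun f => by
      simpa using hn k f).continuous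
    exact (hcont.comp (continuous_translate f)).congr fun q => heq k q f
  · rw [h1]
    exact FInf.tmul_unit (fun ξ => (hφ1 ξ).1) (fun η => (hψ1 η).1) x

omit [T2Space G] in
/-- A finite Rokhlin dimension is attained. -/
theorem exists_of_rokhlinDimC_ne_top {A : Type*} [NonUnitalCStarAlgebra A] {α : CStarAction G A}
    (h : rokhlinDimC α ≠ ⊤) : ∃ d : ℕ, RokhlinDimCLE α d ∧ rokhlinDimC α = d := by
  have hne : ((fun d : ℕ => (d : ℕ∞)) '' {d | RokhlinDimCLE α d}).Nonempty := by
    by_contra hc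
    refine h ?_
    rw [rokhlinDimC, Set.not_nonempty_iff_eq_empty.1 hc, sInf_empty]
  obtain ⟨d, hd, hdeq⟩ := csInf_mem hne
  exact ⟨d, hd, hdeq.symm⟩

end Final

end CRokhlin

end

theorem mainTheorem9
    {n₁ n₂ : ℕ}
    {H₁ : Type*} [Group H₁] [TopologicalSpace H₁] [IsTopologicalGroup H₁]
    [CompactSpace H₁] [T2Space H₁]
    [ChartedSpace (EuclideanSpace ℝ (Fin n₁)) H₁] [LieGroup (𝓡 n₁) ∞ H₁]
    {H₂ : Type*} [Group H₂] [TopologicalSpace H₂] [IsTopologicalGroup H₂]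
    [CompactSpace H₂] [T2Space H₂]
    [ChartedSpace (EuclideanSpace ℝ (Fin n₂)) H₂] [LieGroup (𝓡 n₂) ∞ H₂]
    {B₁ : Type*} [NonUnitalCStarAlgebra B₁] [TopologicalSpace.SeparableSpace B₁]
    {B₂ : Type*} [NonUnitalCStarAlgebra B₂] [TopologicalSpace.SeparableSpace B₂]
    (β₁ : CRokhlin.CStarAction H₁ B₁) (β₂ : CRokhlin.CStarAction H₂ B₂) :
    CRokhlin.rokhlinDimC (β₁.prod β₂) ≤
      CRokhlin.rokhlinDimC β₁ + CRokhlin.rokhlinDimC β₂ := by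
  by_cases h₁ : CRokhlin.rokhlinDimC β₁ = ⊤
  · simp [h₁]
  by_cases h₂ : CRokhlin.rokhlinDimC β₂ = ⊤
  · simp [h₂]
  obtain ⟨d₁, hd₁, e₁⟩ := CRokhlin.exists_of_rokhlinDimC_ne_top h₁
  obtain ⟨d₂, hd₂, e₂⟩ := CRokhlin.exists_of_rokhlinDimC_ne_top h₂
  rw [e₁, e₂, ← Nat.cast_add]
  exact sInf_le ⟨d₁ + d₂, CRokhlin.rokhlinDimCLE_prod hd₁ hd₂, rfl⟩
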